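/- Fix one of the three settings $k\in\{\mathbb E_1,\mathbb E_2,\mathbb E_\infty\}$ (monoidal, braided monoidal, symmetric monoidal). "Functor" and "natural transformation" below are (strong) monoidal, braided when $k\neq\mathbb E_1$. **Dagger categories.** $\mathrm{Cat}^\dagger_k$ is the strict 2-category of dagger categories $D$ with a $k$-monoidal structure such that $(f\otimes g)^\dagger=f^\dagger\otimes g^\dagger$ and the associator, the unitors and the braiding (if any) are unitary. Its 1-morphisms are the $k$-monoidal functors $F$ with $F(f^\dagger)=F(f)^\dagger$ whose structure isomorphisms $1\to F1$, $Fx\otimes Fy\to F(x\otimes y)$ are unitary; its 2-morphisms are the monoidal natural transformations with isometric components ($\tau_x^\dagger\tau_x=\mathrm{id}$). **Anti-involutive categories.** $\mathrm{aICat}_k$ is the strict 2-category of $k$-monoidal categories $C$ with a $k$-monoidal functor $d\colon C\to C^{\mathrm{op}}$ (with data $u\colon 1\cong d1$ and $\chi_{x,y}\colon dx\otimes dy\cong d(x\otimes y)$; $C^{\mathrm{op}}$ has the inverse braiding) and a monoidal natural isomorphism $\eta\colon\mathrm{id}\cong d^2$ with $d(\eta_c)\circ\eta_{dc}=\mathrm{id}_{dc}$.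 Its 1-morphisms are the $k$-monoidal functors $F$ with a monoidal natural isomorphism $\varphi_x\colon F(dx)\cong d(Fx)$ satisfying $\varphi_{dx}\circ F(\eta_x)=d(\varphi_x)\circ\eta_{Fx}$; its 2-morphisms $(F,\varphi)\to(G,\psi)$ are the monoidal natural transformations $\tau$ with $\varphi_x=d(\tau_x)\circ\psi_x\circ\tau_{dx}$. The canonical ("forgetful") 2-functor $\mathrm{Cat}^\dagger_k\to\mathrm{aICat}_k$ regards $D$ as anti-involutive with $d=\dagger$ and $\eta,u,\chi$ identities, and $F$ as anti-involutive with $\varphi=\mathrm{id}$. **Hermitian completion.** A Hermitian pairing on $c\in C$ is an isomorphism $h\colon c\to dc$ with $d(h)\circ\eta_c=h$. $\operatorname{Herm}C$ has as objects the pairs $(c,h)$ with $h$ a Hermitian pairing on $c$; as morphisms $(c_1,h_1)\to(c_2,h_2)$ all morphisms $f\colon c_1\to c_2$; dagger $f^\dagger=h_1^{-1}\circ d(f)\circ h_2$; tensor product $(c,h)\otimes(c',h')=(c\otimes c',\chi_{c,c'}\circ(h\otimes h'))$; unit $(1,u)$; and the associator, unitors and braiding of $C$. A 1-morphism $(F,\varphi)$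 induces $(c,h)\mapsto(Fc,\varphi_c\circ F(h))$, $f\mapsto F(f)$, with the monoidal structure isomorphisms of $F$; a 2-morphism $\tau$ induces $\tau$. **Positivity structures.** A monoidal positivity structure $P$ on $C$ is a collection of objects of $\operatorname{Herm}C$ such that every $c\in C$ has some $(c,h)\in P$; that is closed under transfer: if $(c,h)\in P$ and $g\colon c'\to c$ is an isomorphism, then $(c',\,d(g)\circ h\circ g)\in P$; and that is closed under $\otimes$. (It then contains $(1,u)$.) Let $C_P\subseteq\operatorname{Herm}C$ be the full dagger subcategory on $P$. $(\mathrm{aICat}_k)_P$ is the strict 2-category of pairs $(C,P)$, whose 1-morphisms are the 1-morphisms $(F,\varphi)$ of $\mathrm{aICat}_k$ that send positive pairings to positive pairings, $(c,h)\in P\Rightarrow(Fc,\varphi_c\circ F(h))\in P'$, and whose 2-morphisms are all 2-morphisms between these. For $D\in\mathrm{Cat}^\dagger_k$ let $\operatorname{Pos}(D)$ be the positivity structure on $D$, regarded as anti-involutive, of all pairings $g^\dagger\circ g$ with $g$ an isomorphism of $D$ with source $c$. **Theorem.** For each of $k=\mathbb E_1,\mathbb E_2,\mathbb E_\infty$: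 1. The assignments above on objects, 1-morphisms and 2-morphisms make $\operatorname{Herm}\colon\mathrm{aICat}_k\to\mathrm{Cat}^\dagger_k$ a strict 2-functor, and it is strictly right adjoint to the canonical 2-functor $\mathrm{Cat}^\dagger_k\to\mathrm{aICat}_k$: there are strictly 2-natural unit and counit satisfying the triangle identities on the nose. 2. It restricts to a strict 2-functor $(\mathrm{aICat}_k)_P\to\mathrm{Cat}^\dagger_k$, $(C,P)\mapsto C_P$. This is strictly right adjoint to the strict 2-functor $\mathrm{Cat}^\dagger_k\to(\mathrm{aICat}_k)_P$, $D\mapsto(D,\operatorname{Pos}(D))$ (given by the canonical 2-functor on 1- and 2-morphisms), by an adjunction all of whose unit and counit components are equivalences in the respective 2-categories. In particular $\mathrm{Cat}^\dagger_k$ and $(\mathrm{aICat}_k)_P$ are 2-equivalent. -/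

import Mathlib

open CategoryTheory MonoidalCategory Opposite

universe v u v₁ u₁ v₂ u₂

namespace DaggerHerm

/-! ### Dagger categories -/

/-- A dagger structure on `C`: an identity-on-objects functor `Cᵒᵖ ⥤ C` squaring to the identity. -/
class DaggerCategory (C : Type u) [Category.{v} C] where
  dag : ∀ {X Y : C}, (X ⟶ Y) → (Y ⟶ X)
  dag_id : ∀ X : C, dag (𝟙 X) = 𝟙 X
  dag_comp : ∀ {X Y Z : C} (f : X ⟶ Y) (g : Y ⟶ Z), dag (f ≫ g) = dag g ≫ dag f
  dag_dag : ∀ {X Y : C} (f : X ⟶ Y), dag (dag f) = f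

open DaggerCategory (dag dag_id dag_comp dag_dag)

section

variable {C : Type u} [Category.{v} C] [DaggerCategory C]

/-- `f` is an isometry: `f† ∘ f = id`. -/
def IsIsometry {X Y : C} (f : X ⟶ Y) : Prop := f ≫ dag f = 𝟙 X

/-- `f` is unitary: `f† ∘ f = id` and `f ∘ f† = id`. -/
def IsUnitary {X Y : C} (f : X ⟶ Y) : Prop := f ≫ dag f = 𝟙 X ∧ dag f ≫ f = 𝟙 Y

/-- An endomorphism is iso-positive if it is of the form `g† ∘ g` for some isomorphism `g`. -/
def IsIsoPositive {X : C} (f : X ⟶ X) : Prop := ∃ (Y : C) (g : X ≅ Y), f = g.hom ≫ dag g.hom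

end

/-- The compatibility making a monoidal category with a dagger a monoidal dagger category. -/
class MonoidalDagger (C : Type u) [Category.{v} C] [MonoidalCategory C] [DaggerCategory C] :
    Prop where
  dag_tensorHom : ∀ {X₁ Y₁ X₂ Y₂ : C} (f : X₁ ⟶ Y₁) (g : X₂ ⟶ Y₂),
    dag (f ⊗ₘ g) = dag f ⊗ₘ dag g
  unitary_associator : ∀ X Y Z : C, IsUnitary (α_ X Y Z).hom
  unitary_leftUnitor : ∀ X : C, IsUnitary (λ_ X).hom
  unitary_rightUnitor : ∀ X : C, IsUnitary (ρ_ X).hom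

/-! ### Anti-involutive categories and Hermitian pairings -/

/-- An anti-involution on `C`: a contravariant functor `d` (written as a functor `Cᵒᵖ ⥤ C`) and a
natural isomorphism `η : id ≅ d ∘ d` such that `d(η_c)` is the inverse of `η_{dc}`. -/
class AntiInvolution (C : Type u) [Category.{v} C] where
  d : Cᵒᵖ ⥤ C
  eta : 𝟭 C ≅ d.rightOp ⋙ d
  eta_d : ∀ c : C, eta.hom.app (d.obj (op c)) ≫ d.map (eta.hom.app c).op = 𝟙 (d.obj (op c))

section

variable {C : Type u} [Category.{v} C] [AntiInvolution C]

/-- `d` on objects. -/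
abbrev dObj (X : C) : C := AntiInvolution.d.obj (op X)

/-- `d` on morphisms. -/
abbrev dMap {X Y : C} (f : X ⟶ Y) : dObj Y ⟶ dObj X := AntiInvolution.d.map f.op

/-- The components of `η`. -/
abbrev etaApp (X : C) : X ⟶ dObj (dObj X) := AntiInvolution.eta.hom.app X

lemma dMap_id (X : C) : dMap (𝟙 X) = 𝟙 (dObj X) := by simp [dMap]

lemma dMap_comp {X Y Z : C} (f : X ⟶ Y) (g : Y ⟶ Z) : dMap (f ≫ g) = dMap g ≫ dMap f := by
  simp [dMap]

lemma eta_natural {X Y : C} (f : X ⟶ Y) : f ≫ etaApp Y = etaApp X ≫ dMap (dMap f) :=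
  AntiInvolution.eta.hom.naturality f

lemma etaApp_dMap (X : C) : etaApp (dObj X) ≫ dMap (etaApp X) = 𝟙 (dObj X) :=
  AntiInvolution.eta_d X

instance isIso_dMap {X Y : C} (f : X ⟶ Y) [IsIso f] : IsIso (dMap f) := by
  unfold dMap; infer_instance

end

/-- The condition that an isomorphism `h : c ≅ dc` is a Hermitian pairing. -/
def IsHermitian {C : Type u} [Category.{v} C] [AntiInvolution C] {c : C} (h : c ≅ dObj c) : Prop :=
  etaApp c ≫ dMap h.hom = h.hom

/-- Objects of the Hermitian completion `Herm C`: objects with a Hermitian pairing. -/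
@[ext]
structure Herm (C : Type u) [Category.{v} C] [AntiInvolution C] where
  obj : C
  pairing : obj ≅ dObj obj
  hermitian : IsHermitian pairing

namespace Herm

section

variable {C : Type u} [Category.{v} C] [AntiInvolution C]

/-- Morphisms of the Hermitian completion: all morphisms between the underlying objects. -/
@[ext]
structure Hom (X Y : Herm C) where
  hom : X.obj ⟶ Y.obj

instance category : Category.{v} (Herm C) where
  Hom X Y := Hom X Y
  id X := ⟨𝟙 X.obj⟩
  comp f g := ⟨f.hom ≫ g.hom⟩

@[ext]
lemma hom_ext {X Y : Herm C} {f g : X ⟶ Y} (h : f.hom = g.hom) : f = g := Hom.ext h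

@[simp] lemma id_hom (X : Herm C) : Hom.hom (𝟙 X) = 𝟙 X.obj := rfl

@[simp] lemma comp_hom {X Y Z : Herm C} (f : X ⟶ Y) (g : Y ⟶ Z) :
    (f ≫ g).hom = f.hom ≫ g.hom := rfl

/-- An isomorphism of underlying objects gives an isomorphism in the Hermitian completion. -/
@[simps]
def isoMk {X Y : Herm C} (e : X.obj ≅ Y.obj) : X ≅ Y where
  hom := ⟨e.hom⟩
  inv := ⟨e.inv⟩

variable (C) in
/-- The functor forgetting the Hermitian pairing. -/
@[simps]
def forget : Herm C ⥤ C where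
  obj X := X.obj
  map f := f.hom

instance : (forget C).Faithful where
  map_injective h := hom_ext h

lemma pairing_dMap (X : Herm C) : etaApp X.obj ≫ dMap X.pairing.hom = X.pairing.hom := X.hermitian

lemma pairing_inv_eta (X : Herm C) : X.pairing.inv ≫ etaApp X.obj = inv (dMap X.pairing.hom) := by
  rw [Iso.inv_comp_eq, IsIso.eq_comp_inv, pairing_dMap]

/-- The dagger of `f : (c₁, h₁) ⟶ (c₂, h₂)` is `h₁⁻¹ ∘ d f ∘ h₂`. -/
instance dagger : DaggerCategory (Herm C) where
  dag {X Y} f := ⟨Y.pairing.hom ≫ dMap f.hom ≫ X.pairing.inv⟩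
  dag_id X := by ext; simp [dMap_id]
  dag_comp f g := by ext; simp [dMap_comp]
  dag_dag {X Y} f := by
    ext
    have e : dMap (Y.pairing.hom ≫ dMap f.hom ≫ X.pairing.inv) =
        dMap X.pairing.inv ≫ dMap (dMap f.hom) ≫ dMap Y.pairing.hom := by
      simp only [dMap_comp, Category.assoc]
    have e2 : dMap X.pairing.inv = inv (dMap X.pairing.hom) := by
      apply IsIso.eq_inv_of_hom_inv_id
      rw [← dMap_comp, Iso.inv_hom_id, dMap_id]
    dsimp only
    rw [e, e2, ← pairing_inv_eta]
    simp only [Category.assoc, Iso.hom_inv_id_assoc]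
    rw [← reassoc_of% (eta_natural f.hom), reassoc_of% (pairing_dMap Y), Iso.hom_inv_id,
      Category.comp_id]

lemma dag_hom {X Y : Herm C} (f : X ⟶ Y) :
    (dag f).hom = Y.pairing.hom ≫ dMap f.hom ≫ X.pairing.inv := rfl

lemma isUnitary_iff_of_iso {X Y : Herm C} (f : X ≅ Y) :
    IsUnitary f.hom ↔ f.hom.hom ≫ Y.pairing.hom ≫ dMap f.hom.hom = X.pairing.hom := by
  have key : f.hom ≫ dag f.hom = 𝟙 X ↔
      f.hom.hom ≫ Y.pairing.hom ≫ dMap f.hom.hom = X.pairing.hom := by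
    rw [← cancel_mono X.pairing.inv]
    simp only [Category.assoc, Iso.hom_inv_id]
    exact ⟨fun h => congrArg Hom.hom h, fun h => hom_ext h⟩
  constructor
  · exact fun h => key.1 h.1
  · intro h
    have h1 := key.2 h
    refine ⟨h1, ?_⟩
    have h2 : dag f.hom = f.inv := by rw [← cancel_epi f.hom, h1, Iso.hom_inv_id]
    rw [h2, Iso.inv_hom_id]

/-- The transfer of a Hermitian pairing `h` on `c` along an isomorphism `g : c' ≅ c`: the Hermitian
pairing `d g ∘ h ∘ g` on `c'`. -/
@[simps]
def transfer (X : Herm C) {c : C} (g : c ≅ X.obj) : Herm C where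
  obj := c
  pairing :=
    { hom := g.hom ≫ X.pairing.hom ≫ dMap g.hom
      inv := dMap g.inv ≫ X.pairing.inv ≫ g.inv
      hom_inv_id := by
        simp only [Category.assoc]
        rw [← reassoc_of% (dMap_comp g.inv g.hom)]
        simp [dMap_id]
      inv_hom_id := by
        simp only [Category.assoc, Iso.inv_hom_id_assoc]
        rw [← dMap_comp]
        simp [dMap_id] }
  hermitian := by
    change etaApp c ≫ dMap (g.hom ≫ X.pairing.hom ≫ dMap g.hom) = _
    simp only [dMap_comp, Category.assoc]
    rw [← reassoc_of% (eta_natural g.hom), reassoc_of% (pairing_dMap X)]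

end

end Herm

/-! ### Monoidal anti-involutions and the monoidal structure of the Hermitian completion -/

/-- A monoidal anti-involution: `d` is a strong monoidal functor and `η` is a monoidal natural
isomorphism. Here `Cᵒᵖ` carries the same tensor product as `C`. -/
class MonoidalAntiInvolution (C : Type u) [Category.{v} C] [MonoidalCategory C] extends
    AntiInvolution C where
  monoidal : d.Monoidal
  eta_unit : eta.hom.app (𝟙_ C) ≫ d.map (Functor.LaxMonoidal.ε d).op = Functor.LaxMonoidal.ε d
  eta_tensor : ∀ X Y : C,
    eta.hom.app (X ⊗ Y) ≫ d.map (Functor.LaxMonoidal.μ d (op X) (op Y)).op =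
      (eta.hom.app X ⊗ₘ eta.hom.app Y) ≫
        Functor.LaxMonoidal.μ d (op (d.obj (op X))) (op (d.obj (op Y)))

attribute [reducible, instance] MonoidalAntiInvolution.monoidal

section

variable {C : Type u} [Category.{v} C] [MonoidalCategory C] [MonoidalAntiInvolution C]

/-- The unit datum `u : 1 ≅ d 1` of `d`. -/
abbrev uIso (C : Type u) [Category.{v} C] [MonoidalCategory C] [MonoidalAntiInvolution C] :
    𝟙_ C ≅ dObj (𝟙_ C) :=
  Functor.Monoidal.εIso AntiInvolution.d

/-- The datum `χ : dX ⊗ dY ≅ d(X ⊗ Y)` of `d`. -/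
abbrev chi (X Y : C) : dObj X ⊗ dObj Y ≅ dObj (X ⊗ Y) :=
  Functor.Monoidal.μIso AntiInvolution.d (op X) (op Y)

lemma etaApp_unit : etaApp (𝟙_ C) ≫ dMap (uIso C).hom = (uIso C).hom :=
  MonoidalAntiInvolution.eta_unit

lemma etaApp_tensor (X Y : C) : etaApp (X ⊗ Y) ≫ dMap (chi X Y).hom =
    (etaApp X ⊗ₘ etaApp Y) ≫ (chi (dObj X) (dObj Y)).hom :=
  MonoidalAntiInvolution.eta_tensor X Y

lemma chi_natural {X X' Y Y' : C} (f : X ⟶ X') (g : Y ⟶ Y') :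
    (dMap f ⊗ₘ dMap g) ≫ (chi X Y).hom = (chi X' Y').hom ≫ dMap (f ⊗ₘ g) :=
  Functor.LaxMonoidal.μ_natural AntiInvolution.d f.op g.op

lemma chi_associativity (X Y Z : C) :
    ((chi X Y).hom ▷ dObj Z) ≫ (chi (X ⊗ Y) Z).hom ≫ dMap (α_ X Y Z).inv =
      (α_ (dObj X) (dObj Y) (dObj Z)).hom ≫ (dObj X ◁ (chi Y Z).hom) ≫ (chi X (Y ⊗ Z)).hom :=
  Functor.LaxMonoidal.associativity AntiInvolution.d (op X) (op Y) (op Z)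

lemma chi_left_unitality (X : C) : (λ_ (dObj X)).hom =
    ((uIso C).hom ▷ dObj X) ≫ (chi (𝟙_ C) X).hom ≫ dMap (λ_ X).inv :=
  Functor.LaxMonoidal.left_unitality AntiInvolution.d (op X)

lemma chi_right_unitality (X : C) : (ρ_ (dObj X)).hom =
    (dObj X ◁ (uIso C).hom) ≫ (chi X (𝟙_ C)).hom ≫ dMap (ρ_ X).inv :=
  Functor.LaxMonoidal.right_unitality AntiInvolution.d (op X)

end

namespace Herm

section

variable {C : Type u} [Category.{v} C] [MonoidalCategory C] [MonoidalAntiInvolution C]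

/-- The tensor product of Hermitian pairings: `χ ∘ (h₁ ⊗ h₂)`. -/
@[simps]
def tensor (X Y : Herm C) : Herm C where
  obj := X.obj ⊗ Y.obj
  pairing := (X.pairing ⊗ᵢ Y.pairing) ≪≫ chi X.obj Y.obj
  hermitian := by
    change etaApp (X.obj ⊗ Y.obj) ≫ dMap ((X.pairing.hom ⊗ₘ Y.pairing.hom) ≫ (chi _ _).hom) = _
    rw [dMap_comp, reassoc_of% (etaApp_tensor X.obj Y.obj), ← chi_natural, tensorHom_comp_tensorHom_assoc,
      pairing_dMap, pairing_dMap]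
    rfl

variable (C) in
/-- The monoidal unit with the Hermitian pairing `u : 1 ≅ d 1`. -/
@[simps]
def unit : Herm C where
  obj := 𝟙_ C
  pairing := uIso C
  hermitian := etaApp_unit

@[simps]
instance monoidalCategoryStruct : MonoidalCategoryStruct (Herm C) where
  tensorObj X Y := tensor X Y
  whiskerLeft X _ _ f := ⟨X.obj ◁ f.hom⟩
  whiskerRight f Y := ⟨f.hom ▷ Y.obj⟩
  tensorHom f g := ⟨f.hom ⊗ₘ g.hom⟩
  tensorUnit := unit C
  associator X Y Z := isoMk (α_ X.obj Y.obj Z.obj)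
  leftUnitor X := isoMk (λ_ X.obj)
  rightUnitor X := isoMk (ρ_ X.obj)

instance monoidalCategory : MonoidalCategory (Herm C) where
  tensorHom_def f g := hom_ext (tensorHom_def f.hom g.hom)
  id_tensorHom_id X Y := hom_ext (id_tensorHom_id X.obj Y.obj)
  tensorHom_comp_tensorHom f g h k := hom_ext (tensorHom_comp_tensorHom f.hom g.hom h.hom k.hom)
  whiskerLeft_id X Y := hom_ext (whiskerLeft_id X.obj Y.obj)
  id_whiskerRight X Y := hom_ext (id_whiskerRight X.obj Y.obj)
  associator_naturality f g h := hom_ext (associator_naturality f.hom g.hom h.hom)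
  leftUnitor_naturality f := hom_ext (leftUnitor_naturality f.hom)
  rightUnitor_naturality f := hom_ext (rightUnitor_naturality f.hom)
  pentagon W X Y Z := hom_ext (pentagon W.obj X.obj Y.obj Z.obj)
  triangle X Y := hom_ext (triangle X.obj Y.obj)

instance monoidalDagger : MonoidalDagger (Herm C) where
  dag_tensorHom {X₁ Y₁ X₂ Y₂} f g := by
    ext
    change ((Y₁.pairing.hom ⊗ₘ Y₂.pairing.hom) ≫ (chi _ _).hom) ≫ dMap (f.hom ⊗ₘ g.hom) ≫
      (chi X₁.obj X₂.obj).inv ≫ (X₁.pairing.inv ⊗ₘ X₂.pairing.inv) =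
      (Y₁.pairing.hom ≫ dMap f.hom ≫ X₁.pairing.inv) ⊗ₘ
        (Y₂.pairing.hom ≫ dMap g.hom ≫ X₂.pairing.inv)
    rw [Category.assoc, ← reassoc_of% (chi_natural f.hom g.hom), Iso.hom_inv_id_assoc]
    simp only [tensorHom_comp_tensorHom]
  unitary_associator X Y Z := by
    rw [isUnitary_iff_of_iso]
    change (α_ X.obj Y.obj Z.obj).hom ≫ ((X.pairing.hom ⊗ₘ ((Y.pairing.hom ⊗ₘ Z.pairing.hom) ≫
      (chi Y.obj Z.obj).hom)) ≫ (chi X.obj (Y.obj ⊗ Z.obj)).hom) ≫ dMap (α_ X.obj Y.obj Z.obj).hom =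
      ((((X.pairing.hom ⊗ₘ Y.pairing.hom) ≫ (chi X.obj Y.obj).hom) ⊗ₘ Z.pairing.hom) ≫
        (chi (X.obj ⊗ Y.obj) Z.obj).hom)
    have h := chi_associativity X.obj Y.obj Z.obj
    have h2 : dMap (α_ X.obj Y.obj Z.obj).inv ≫ dMap (α_ X.obj Y.obj Z.obj).hom = 𝟙 _ := by
      rw [← dMap_comp, Iso.hom_inv_id, dMap_id]
    have h3 : ((chi X.obj Y.obj).hom ▷ dObj Z.obj) ≫ (chi (X.obj ⊗ Y.obj) Z.obj).hom =
        (α_ _ _ _).hom ≫ (dObj X.obj ◁ (chi Y.obj Z.obj).hom) ≫ (chi X.obj (Y.obj ⊗ Z.obj)).hom ≫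
        dMap (α_ X.obj Y.obj Z.obj).hom := by
      rw [← reassoc_of% h, h2, Category.comp_id]
    have e1 : (((X.pairing.hom ⊗ₘ Y.pairing.hom) ≫ (chi X.obj Y.obj).hom) ⊗ₘ Z.pairing.hom) =
        ((X.pairing.hom ⊗ₘ Y.pairing.hom) ⊗ₘ Z.pairing.hom) ≫
          ((chi X.obj Y.obj).hom ▷ dObj Z.obj) := by
      rw [← tensorHom_id, tensorHom_comp_tensorHom, Category.comp_id]
    have e2 : (X.pairing.hom ⊗ₘ ((Y.pairing.hom ⊗ₘ Z.pairing.hom) ≫ (chi Y.obj Z.obj).hom)) =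
        (X.pairing.hom ⊗ₘ (Y.pairing.hom ⊗ₘ Z.pairing.hom)) ≫
          (dObj X.obj ◁ (chi Y.obj Z.obj).hom) := by
      rw [← id_tensorHom, tensorHom_comp_tensorHom, Category.comp_id]
    rw [e1, e2]
    simp only [Category.assoc]
    rw [h3, associator_naturality_assoc]
  unitary_leftUnitor X := by
    rw [isUnitary_iff_of_iso]
    change (λ_ X.obj).hom ≫ X.pairing.hom ≫ dMap (λ_ X.obj).hom =
      ((uIso C).hom ⊗ₘ X.pairing.hom) ≫ (chi (𝟙_ C) X.obj).hom
    have h2 : dMap (λ_ X.obj).inv ≫ dMap (λ_ X.obj).hom = 𝟙 _ := by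
      rw [← dMap_comp, Iso.hom_inv_id, dMap_id]
    rw [← leftUnitor_naturality_assoc, chi_left_unitality, Category.assoc, Category.assoc, h2,
      Category.comp_id, ← id_tensorHom, ← tensorHom_id, tensorHom_comp_tensorHom_assoc,
      Category.id_comp, Category.comp_id]
  unitary_rightUnitor X := by
    rw [isUnitary_iff_of_iso]
    change (ρ_ X.obj).hom ≫ X.pairing.hom ≫ dMap (ρ_ X.obj).hom =
      (X.pairing.hom ⊗ₘ (uIso C).hom) ≫ (chi X.obj (𝟙_ C)).hom
    have h2 : dMap (ρ_ X.obj).inv ≫ dMap (ρ_ X.obj).hom = 𝟙 _ := by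
      rw [← dMap_comp, Iso.hom_inv_id, dMap_id]
    rw [← rightUnitor_naturality_assoc, chi_right_unitality, Category.assoc, Category.assoc, h2,
      Category.comp_id, ← id_tensorHom, ← tensorHom_id, tensorHom_comp_tensorHom_assoc,
      Category.id_comp, Category.comp_id]

end

end Herm

/-! ### The three levels of commutativity -/

/-- The three settings: monoidal (`E1`), braided monoidal (`E2`) and symmetric monoidal (`Einf`). -/
inductive Level
  | E1
  | E2
  | Einf

/-- The levels at which a braiding is part of the structure. -/
def Level.IsBraided (k : Level) : Prop := k ≠ Level.E1

/-- The extra structure on a monoidal category at level `k`: nothing for `E1`, a braiding for `E2`,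
a symmetric braiding for `Einf`. -/
structure BraidingData (k : Level) (C : Type u) [Category.{v} C] [MonoidalCategory C] where
  braiding : k.IsBraided → BraidedCategory C
  symmetric : k = Level.Einf → ∀ (hk : k.IsBraided) (X Y : C),
    ((braiding hk).braiding X Y).hom ≫ ((braiding hk).braiding Y X).hom = 𝟙 (X ⊗ Y)

namespace BraidingData

variable {k : Level}

/-- The braiding `X ⊗ Y ≅ Y ⊗ X`. -/
def beta {C : Type u} [Category.{v} C] [MonoidalCategory C] (B : BraidingData k C)
    (hk : k.IsBraided) (X Y : C) : X ⊗ Y ≅ Y ⊗ X :=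
  (B.braiding hk).braiding X Y

/-- The braiding (if any) is unitary. -/
def IsUnitary {C : Type u} [Category.{v} C] [MonoidalCategory C] [DaggerCategory C]
    (B : BraidingData k C) : Prop :=
  ∀ (hk : k.IsBraided) (X Y : C), DaggerHerm.IsUnitary (B.beta hk X Y).hom

/-- The monoidal functor `d : C ⥤ Cᵒᵖ` is braided (if there is a braiding), where `Cᵒᵖ` carries the
inverse braiding. -/
def IsBraidedAntiInvolution {C : Type u} [Category.{v} C] [MonoidalCategory C]
    [MonoidalAntiInvolution C] (B : BraidingData k C) : Prop :=
  ∀ (hk : k.IsBraided) (X Y : C),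
    (chi X Y).hom ≫ dMap (B.beta hk X Y).inv = (B.beta hk (dObj X) (dObj Y)).hom ≫ (chi Y X).hom

/-- The monoidal functor `F` is braided (if there are braidings). -/
def IsPreservedBy {C : Type u₁} [Category.{v₁} C] [MonoidalCategory C] {D : Type u₂}
    [Category.{v₂} D] [MonoidalCategory D] (B : BraidingData k C) (B' : BraidingData k D)
    (F : C ⥤ D) [F.Monoidal] : Prop :=
  ∀ (hk : k.IsBraided) (X Y : C),
    Functor.LaxMonoidal.μ F X Y ≫ F.map (B.beta hk X Y).hom =
      (B'.beta hk (F.obj X) (F.obj Y)).hom ≫ Functor.LaxMonoidal.μ F Y X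

lemma isPreservedBy_id {C : Type u₁} [Category.{v₁} C] [MonoidalCategory C]
    (B : BraidingData k C) : B.IsPreservedBy B (𝟭 C) := by
  intro hk X Y
  simp

lemma isPreservedBy_comp {C : Type u₁} [Category.{v₁} C] [MonoidalCategory C] {D : Type u₁}
    [Category.{v₁} D] [MonoidalCategory D] {E : Type u₁} [Category.{v₁} E] [MonoidalCategory E]
    {B : BraidingData k C} {B' : BraidingData k D} {B'' : BraidingData k E}
    {F : C ⥤ D} {G : D ⥤ E} [F.Monoidal] [G.Monoidal] (hF : B.IsPreservedBy B' F)
    (hG : B'.IsPreservedBy B'' G) : B.IsPreservedBy B'' (F ⋙ G) := by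
  intro hk X Y
  have h1 := hF hk X Y
  have h2 := hG hk (F.obj X) (F.obj Y)
  simp only [Functor.LaxMonoidal.comp_μ, Functor.comp_map, Category.assoc, Functor.comp_obj]
  rw [← G.map_comp, h1, G.map_comp, reassoc_of% h2]

end BraidingData

namespace Herm

variable {k : Level} {C : Type u} [Category.{v} C] [MonoidalCategory C] [MonoidalAntiInvolution C]

/-- The braiding of the Hermitian completion is the braiding of the underlying category. -/
def braidingData (B : BraidingData k C) : BraidingData k (Herm C) where
  braiding hk :=
    letI := B.braiding hk
    { braiding := fun X Y => isoMk (β_ X.obj Y.obj)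
      braiding_naturality_right := fun X _ _ f =>
        hom_ext (BraidedCategory.braiding_naturality_right X.obj f.hom)
      braiding_naturality_left := fun f Z =>
        hom_ext (BraidedCategory.braiding_naturality_left f.hom Z.obj)
      hexagon_forward := fun X Y Z =>
        hom_ext (BraidedCategory.hexagon_forward X.obj Y.obj Z.obj)
      hexagon_reverse := fun X Y Z =>
        hom_ext (BraidedCategory.hexagon_reverse X.obj Y.obj Z.obj) }
  symmetric h hk X Y := hom_ext (B.symmetric h hk X.obj Y.obj)

lemma braidingData_isUnitary {B : BraidingData k C} (hB : B.IsBraidedAntiInvolution) :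
    (braidingData B).IsUnitary := by
  intro hk X Y
  rw [isUnitary_iff_of_iso]
  change (B.beta hk X.obj Y.obj).hom ≫ ((Y.pairing.hom ⊗ₘ X.pairing.hom) ≫
    (chi Y.obj X.obj).hom) ≫ dMap (B.beta hk X.obj Y.obj).hom =
    (X.pairing.hom ⊗ₘ Y.pairing.hom) ≫ (chi X.obj Y.obj).hom
  have h2 : dMap (B.beta hk X.obj Y.obj).inv ≫ dMap (B.beta hk X.obj Y.obj).hom = 𝟙 _ := by
    rw [← dMap_comp, Iso.hom_inv_id, dMap_id]
  have h3 : (X.pairing.hom ⊗ₘ Y.pairing.hom) ≫ (B.beta hk _ _).hom =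
      (B.beta hk X.obj Y.obj).hom ≫ (Y.pairing.hom ⊗ₘ X.pairing.hom) :=
    letI := B.braiding hk
    BraidedCategory.braiding_naturality X.pairing.hom Y.pairing.hom
  rw [Category.assoc, ← reassoc_of% h3, ← reassoc_of% (hB hk X.obj Y.obj), h2, Category.comp_id]

end Herm

/-! ### The 2-category of (braided, symmetric) monoidal anti-involutive categories -/

/-- A (braided, symmetric) monoidal anti-involutive category. -/
structure AICat (k : Level) where
  carrier : Type u
  [category : Category.{v} carrier]
  [monoidal : MonoidalCategory carrier]
  [antiInvolution : MonoidalAntiInvolution carrier]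
  braiding : BraidingData k carrier
  isBraided : braiding.IsBraidedAntiInvolution

attribute [instance] AICat.category AICat.monoidal AICat.antiInvolution

namespace AICat

variable {k : Level}

/-- A (braided, symmetric) monoidal anti-involutive functor. -/
structure Hom (X Y : AICat.{v, u} k) where
  functor : X.carrier ⥤ Y.carrier
  [monoidal : functor.Monoidal]
  /-- The isomorphism with components `F (d x) ≅ d (F x)`. -/
  phi : AntiInvolution.d ⋙ functor ≅ functor.op ⋙ AntiInvolution.d
  phi_eta : ∀ x : X.carrier, functor.map (etaApp x) ≫ phi.hom.app (op (dObj x)) =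
    etaApp (functor.obj x) ≫ dMap (phi.hom.app (op x))
  phi_unit : Functor.LaxMonoidal.ε functor ≫ functor.map (uIso X.carrier).hom ≫
    phi.hom.app (op (𝟙_ X.carrier)) ≫ dMap (Functor.LaxMonoidal.ε functor) = (uIso Y.carrier).hom
  phi_tensor : ∀ x y : X.carrier,
    (phi.hom.app (op x) ⊗ₘ phi.hom.app (op y)) ≫ (chi (functor.obj x) (functor.obj y)).hom =
      Functor.LaxMonoidal.μ functor (dObj x) (dObj y) ≫ functor.map (chi x y).hom ≫
        phi.hom.app (op (x ⊗ y)) ≫ dMap (Functor.LaxMonoidal.μ functor x y)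
  isBraided : X.braiding.IsPreservedBy Y.braiding functor

attribute [instance] Hom.monoidal

namespace Hom

/-- The components `F (d x) ≅ d (F x)`. -/
abbrev phiApp {X Y : AICat.{v, u} k} (F : Hom X Y) (x : X.carrier) :
    F.functor.obj (dObj x) ≅ dObj (F.functor.obj x) :=
  F.phi.app (op x)

lemma phi_natural {X Y : AICat.{v, u} k} (F : Hom X Y) {x y : X.carrier} (f : x ⟶ y) :
    F.functor.map (dMap f) ≫ (F.phiApp x).hom = (F.phiApp y).hom ≫ dMap (F.functor.map f) :=
  F.phi.hom.naturality f.op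

lemma mk_eq {X Y : AICat.{v, u} k} {F : X.carrier ⥤ Y.carrier} {m m' : F.Monoidal}
    {φ φ' : AntiInvolution.d ⋙ F ≅ F.op ⋙ AntiInvolution.d} {a a' b b' c c' d d'}
    (hε : m.ε = m'.ε) (hμ : m.μ = m'.μ) (hφ : ∀ x, φ.hom.app x = φ'.hom.app x) :
    (@Hom.mk k X Y F m φ a b c d) = (@Hom.mk k X Y F m' φ' a' b' c' d') := by
  have h1 : m = m' := by
    apply Functor.Monoidal.toLaxMonoidal_injective
    exact Functor.LaxMonoidal.ext hε hμ
  have h2 : φ = φ' := by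
    ext x
    exact hφ x
  subst h1 h2
  rfl

/-- The identity. -/
@[simps functor]
def id (X : AICat.{v, u} k) : Hom X X where
  functor := 𝟭 _
  phi := Iso.refl _
  phi_eta x := by simp [dMap_id]
  phi_unit := by
    change 𝟙 _ ≫ (uIso X.carrier).hom ≫ 𝟙 _ ≫ dMap (𝟙 _) = _
    simp only [dMap_id, Category.id_comp, Category.comp_id]
  phi_tensor x y := by
    change (𝟙 (dObj x) ⊗ₘ 𝟙 (dObj y)) ≫ (chi x y).hom = 𝟙 _ ≫ (chi x y).hom ≫ 𝟙 _ ≫ dMap (𝟙 _)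
    simp only [dMap_id, id_tensorHom_id, Category.id_comp, Category.comp_id]
  isBraided := BraidingData.isPreservedBy_id _

/-- Composition. -/
@[simps functor]
def comp {X Y Z : AICat.{v, u} k} (F : Hom X Y) (G : Hom Y Z) : Hom X Z where
  functor := F.functor ⋙ G.functor
  phi := NatIso.ofComponents
    (fun x => G.functor.mapIso (F.phiApp x.unop) ≪≫ G.phiApp (F.functor.obj x.unop))
    (fun {x y} f => by
      have h1 := F.phi_natural f.unop
      have h2 := G.phi_natural (F.functor.map f.unop)
      change G.functor.map (F.functor.map (dMap f.unop)) ≫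
        G.functor.map (F.phiApp y.unop).hom ≫ (G.phiApp (F.functor.obj y.unop)).hom =
        (G.functor.map (F.phiApp x.unop).hom ≫ (G.phiApp (F.functor.obj x.unop)).hom) ≫
          dMap (G.functor.map (F.functor.map f.unop))
      rw [← G.functor.map_comp_assoc, h1, G.functor.map_comp_assoc, h2, Category.assoc])
  phi_eta x := by
    change G.functor.map (F.functor.map (etaApp x)) ≫ G.functor.map (F.phiApp (dObj x)).hom ≫
      (G.phiApp (F.functor.obj (dObj x))).hom = etaApp (G.functor.obj (F.functor.obj x)) ≫
        dMap (G.functor.map (F.phiApp x).hom ≫ (G.phiApp (F.functor.obj x)).hom)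
    have h1 : F.functor.map (etaApp x) ≫ (F.phiApp (dObj x)).hom =
      etaApp (F.functor.obj x) ≫ dMap (F.phiApp x).hom := F.phi_eta x
    have h2 : G.functor.map (etaApp (F.functor.obj x)) ≫ (G.phiApp (dObj (F.functor.obj x))).hom =
      etaApp (G.functor.obj (F.functor.obj x)) ≫ dMap (G.phiApp (F.functor.obj x)).hom :=
      G.phi_eta (F.functor.obj x)
    have h3 := G.phi_natural (F.phiApp x).hom
    rw [← G.functor.map_comp_assoc, h1, G.functor.map_comp_assoc, h3, reassoc_of% h2, dMap_comp]
  phi_unit := by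
    have h1 := F.phi_unit
    have h2 := G.phi_unit
    have h3 := G.phi_natural (Functor.LaxMonoidal.ε F.functor)
    change (Functor.LaxMonoidal.ε G.functor ≫ G.functor.map (Functor.LaxMonoidal.ε F.functor)) ≫
      G.functor.map (F.functor.map (uIso X.carrier).hom) ≫
      (G.functor.map (F.phiApp (𝟙_ X.carrier)).hom ≫
        (G.phiApp (F.functor.obj (𝟙_ X.carrier))).hom) ≫
      dMap (Functor.LaxMonoidal.ε G.functor ≫ G.functor.map (Functor.LaxMonoidal.ε F.functor)) = _
    change _ ≫ G.functor.map _ ≫ (G.phiApp (𝟙_ Y.carrier)).hom ≫ _ = _ at h2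
    change _ ≫ F.functor.map _ ≫ (F.phiApp (𝟙_ X.carrier)).hom ≫ _ = _ at h1
    rw [dMap_comp]
    simp only [Category.assoc]
    rw [← reassoc_of% h3]
    simp only [← Functor.map_comp_assoc]
    rw [h1, h2]
  phi_tensor x y := by
    have h1 := F.phi_tensor x y
    have h2 := G.phi_tensor (F.functor.obj x) (F.functor.obj y)
    have h3 := G.phi_natural (Functor.LaxMonoidal.μ F.functor x y)
    change ((G.functor.map (F.phiApp x).hom ≫ (G.phiApp (F.functor.obj x)).hom) ⊗ₘ
      (G.functor.map (F.phiApp y).hom ≫ (G.phiApp (F.functor.obj y)).hom)) ≫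
      (chi (G.functor.obj (F.functor.obj x)) (G.functor.obj (F.functor.obj y))).hom =
      (Functor.LaxMonoidal.μ G.functor (F.functor.obj (dObj x)) (F.functor.obj (dObj y)) ≫
        G.functor.map (Functor.LaxMonoidal.μ F.functor (dObj x) (dObj y))) ≫
      G.functor.map (F.functor.map (chi x y).hom) ≫
      (G.functor.map (F.phiApp (x ⊗ y)).hom ≫ (G.phiApp (F.functor.obj (x ⊗ y))).hom) ≫
      dMap (Functor.LaxMonoidal.μ G.functor (F.functor.obj x) (F.functor.obj y) ≫
        G.functor.map (Functor.LaxMonoidal.μ F.functor x y))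
    change ((G.phiApp (F.functor.obj x)).hom ⊗ₘ (G.phiApp (F.functor.obj y)).hom) ≫ _ =
      _ ≫ G.functor.map _ ≫ (G.phiApp (F.functor.obj x ⊗ F.functor.obj y)).hom ≫ _ at h2
    change ((F.phiApp x).hom ⊗ₘ (F.phiApp y).hom) ≫ _ =
      _ ≫ F.functor.map _ ≫ (F.phiApp (x ⊗ y)).hom ≫ _ at h1
    rw [dMap_comp, ← tensorHom_comp_tensorHom, Category.assoc, h2]
    simp only [Category.assoc]
    rw [← reassoc_of% h3]
    simp only [← Functor.map_comp_assoc]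
    rw [← h1, Functor.map_comp_assoc, Functor.LaxMonoidal.μ_natural_assoc]
  isBraided := BraidingData.isPreservedBy_comp F.isBraided G.isBraided

end Hom

/-- A (braided, symmetric) monoidal anti-involutive natural transformation. -/
structure Hom₂ {X Y : AICat.{v, u} k} (F G : Hom X Y) where
  toNatTrans : F.functor ⟶ G.functor
  isMonoidal : NatTrans.IsMonoidal toNatTrans
  antiInvolutive : ∀ x : X.carrier, (F.phiApp x).hom =
    toNatTrans.app (dObj x) ≫ (G.phiApp x).hom ≫ dMap (toNatTrans.app x)

instance : CategoryStruct (AICat.{v, u} k) where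
  Hom := Hom
  id := Hom.id
  comp := Hom.comp

@[simp] lemma id_functor (X : AICat.{v, u} k) : Hom.functor (𝟙 X) = 𝟭 X.carrier := rfl

@[simp] lemma comp_functor {X Y Z : AICat.{v, u} k} (F : X ⟶ Y) (G : Y ⟶ Z) :
    (F ≫ G).functor = F.functor ⋙ G.functor := rfl

lemma comp_phiApp {X Y Z : AICat.{v, u} k} (F : X ⟶ Y) (G : Y ⟶ Z) (x : X.carrier) :
    (Hom.phiApp (F ≫ G) x).hom =
      G.functor.map (F.phiApp x).hom ≫ (G.phiApp (F.functor.obj x)).hom := rfl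

@[simp] lemma id_phi_app (X : AICat.{v, u} k) (x : X.carrier) :
    (Hom.phi (𝟙 X)).hom.app (op x) = 𝟙 (dObj x) := rfl

@[simp] lemma comp_phi_app {X Y Z : AICat.{v, u} k} (F : X ⟶ Y) (G : Y ⟶ Z) (x : X.carrier) :
    (Hom.phi (F ≫ G)).hom.app (op x) =
      G.functor.map (F.phi.hom.app (op x)) ≫ G.phi.hom.app (op (F.functor.obj x)) := rfl

instance homCategory (X Y : AICat.{v, u} k) : Category (X ⟶ Y) where
  Hom F G := Hom₂ F G
  id F :=
    { toNatTrans := 𝟙 F.functor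
      isMonoidal := inferInstance
      antiInvolutive := fun x => by simp [dMap_id] }
  comp {F G H} σ τ :=
    { toNatTrans := σ.toNatTrans ≫ τ.toNatTrans
      isMonoidal := by
        have := σ.isMonoidal
        have := τ.isMonoidal
        infer_instance
      antiInvolutive := fun x => by
        rw [NatTrans.comp_app, NatTrans.comp_app, dMap_comp, σ.antiInvolutive, τ.antiInvolutive]
        simp only [Category.assoc] }
  id_comp _ := by congr 1; exact Category.id_comp _
  comp_id _ := by congr 1; exact Category.comp_id _
  assoc _ _ _ := by congr 1; exact Category.assoc _ _ _

lemma hom₂_ext {X Y : AICat.{v, u} k} {F G : X ⟶ Y} {σ τ : F ⟶ G}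
    (h : ∀ x, σ.toNatTrans.app x = τ.toNatTrans.app x) : σ = τ := by
  obtain ⟨s, hs, hs'⟩ := σ
  obtain ⟨t, ht, ht'⟩ := τ
  obtain rfl : s = t := NatTrans.ext (funext h)
  rfl

@[simp] lemma id_app {X Y : AICat.{v, u} k} (F : X ⟶ Y) (x : X.carrier) :
    (Hom₂.toNatTrans (𝟙 F)).app x = 𝟙 (F.functor.obj x) := rfl

@[simp] lemma comp_app {X Y : AICat.{v, u} k} {F G H : X ⟶ Y} (σ : F ⟶ G) (τ : G ⟶ H)
    (x : X.carrier) :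
    (σ ≫ τ).toNatTrans.app x = σ.toNatTrans.app x ≫ τ.toNatTrans.app x := rfl

/-- An invertible 2-morphism between 1-morphisms with the same underlying functor, all of whose
components are identities. -/
def isoOfId {X Y : AICat.{v, u} k} (F G : X ⟶ Y) (e : F.functor ≅ G.functor)
    (h₁ : NatTrans.IsMonoidal e.hom) (h₂ : ∀ x : X.carrier, (F.phiApp x).hom =
    e.hom.app (dObj x) ≫ (G.phiApp x).hom ≫ dMap (e.hom.app x)) : F ≅ G where
  hom := ⟨e.hom, h₁, h₂⟩
  inv := ⟨e.inv, inferInstance, fun x => by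
    have h3 : dMap (e.hom.app x) ≫ dMap (e.inv.app x) = 𝟙 _ := by
      rw [← dMap_comp, Iso.inv_hom_id_app, dMap_id]
    rw [h₂ x]
    simp [h3]⟩
  hom_inv_id := hom₂_ext fun x => e.hom_inv_id_app x
  inv_hom_id := hom₂_ext fun x => e.inv_hom_id_app x

instance bicategory : Bicategory (AICat.{v, u} k) where
  homCategory := homCategory
  whiskerLeft {X Y Z} F {G H} τ :=
    { toNatTrans := Functor.whiskerLeft F.functor τ.toNatTrans
      isMonoidal := by
        have := τ.isMonoidal
        change NatTrans.IsMonoidal (Functor.whiskerLeft F.functor τ.toNatTrans)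
        infer_instance
      antiInvolutive := fun x => by
        rw [comp_phiApp, comp_phiApp, τ.antiInvolutive]
        simp }
  whiskerRight {X Y Z} {F G} τ H :=
    { toNatTrans := Functor.whiskerRight τ.toNatTrans H.functor
      isMonoidal := by
        have := τ.isMonoidal
        change NatTrans.IsMonoidal (Functor.whiskerRight τ.toNatTrans H.functor)
        infer_instance
      antiInvolutive := fun x => by
        have h := H.phi_natural (τ.toNatTrans.app x)
        change H.functor.map (F.phiApp x).hom ≫ (H.phiApp (F.functor.obj x)).hom =
          H.functor.map (τ.toNatTrans.app (dObj x)) ≫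
          (H.functor.map (G.phiApp x).hom ≫ (H.phiApp (G.functor.obj x)).hom) ≫
          dMap (H.functor.map (τ.toNatTrans.app x))
        rw [τ.antiInvolutive]
        simp only [Functor.map_comp, Category.assoc]
        rw [h] }
  associator F G H := isoOfId _ _ (Functor.associator F.functor G.functor H.functor)
    (inferInstanceAs (NatTrans.IsMonoidal
      (Functor.associator F.functor G.functor H.functor).hom)) (fun x => by
      simp [dMap_id])
  leftUnitor F := isoOfId _ _ (Functor.leftUnitor F.functor)
    (inferInstanceAs (NatTrans.IsMonoidal (Functor.leftUnitor F.functor).hom)) (fun x => by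
      simp [dMap_id])
  rightUnitor F := isoOfId _ _ (Functor.rightUnitor F.functor)
    (inferInstanceAs (NatTrans.IsMonoidal (Functor.rightUnitor F.functor).hom)) (fun x => by
      simp [dMap_id])
  whiskerLeft_id _ _ := hom₂_ext fun x => by simp
  whiskerLeft_comp _ _ _ _ _ _ := hom₂_ext fun x => by simp
  id_whiskerLeft _ := hom₂_ext fun x => ((Category.id_comp _).trans (Category.comp_id _)).symm
  comp_whiskerLeft _ _ _ _ _ := hom₂_ext fun x => ((Category.id_comp _).trans (Category.comp_id _)).symm
  id_whiskerRight _ _ := hom₂_ext fun x => by simp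
  comp_whiskerRight _ _ _ := hom₂_ext fun x => by simp
  whiskerRight_id _ := hom₂_ext fun x => ((Category.id_comp _).trans (Category.comp_id _)).symm
  whiskerRight_comp _ _ _ := hom₂_ext fun x => ((Category.id_comp _).trans (Category.comp_id _)).symm
  whisker_assoc _ _ _ _ _ := hom₂_ext fun x => ((Category.id_comp _).trans (Category.comp_id _)).symm
  whisker_exchange _ _ := hom₂_ext fun x => by simp
  pentagon _ _ _ K := hom₂_ext fun x => by
    change K.functor.map (𝟙 _) ≫ 𝟙 _ ≫ 𝟙 _ = 𝟙 _ ≫ 𝟙 _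
    simp
  triangle _ G := hom₂_ext fun x => by
    change 𝟙 _ ≫ 𝟙 _ = G.functor.map (𝟙 _)
    simp

lemma eqToIso_app {X Y : AICat.{v, u} k} {F G : X ⟶ Y} (h : F = G) (x : X.carrier) :
    (Hom₂.toNatTrans (eqToIso h).hom).app x =
      eqToHom (congrArg (fun K : Hom X Y => K.functor.obj x) h) := by
  subst h
  rfl

lemma eqToHom_app {X Y : AICat.{v, u} k} {F G : X ⟶ Y} (h : F = G) (x : X.carrier) :
    (Hom₂.toNatTrans (eqToHom h)).app x =
      eqToHom (congrArg (fun K : Hom X Y => K.functor.obj x) h) := by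
  subst h
  rfl

open Functor.LaxMonoidal in
lemma id_comp' {X Y : AICat.{v, u} k} (F : X ⟶ Y) : 𝟙 X ≫ F = F := Hom.mk_eq
    (by change ε F.functor ≫ F.functor.map (𝟙 _) = ε F.functor; simp)
    (by ext x y; change μ F.functor x y ≫ F.functor.map (𝟙 _) = μ F.functor x y; simp)
    (fun x => by change F.functor.map (𝟙 _) ≫ F.phi.hom.app x = F.phi.hom.app x; simp)

open Functor.LaxMonoidal in
lemma comp_id' {X Y : AICat.{v, u} k} (F : X ⟶ Y) : F ≫ 𝟙 Y = F := Hom.mk_eq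
    (by change 𝟙 _ ≫ ε F.functor = ε F.functor; simp)
    (by ext x y; change 𝟙 _ ≫ μ F.functor x y = μ F.functor x y; simp)
    (fun x => by change F.phi.hom.app x ≫ 𝟙 _ = F.phi.hom.app x; simp)

open Functor.LaxMonoidal in
lemma assoc' {W X Y Z : AICat.{v, u} k} (F : W ⟶ X) (G : X ⟶ Y) (H : Y ⟶ Z) :
    (F ≫ G) ≫ H = F ≫ G ≫ H := Hom.mk_eq
    (by
      change ε H.functor ≫ H.functor.map (ε G.functor ≫ G.functor.map (ε F.functor)) =
        (ε H.functor ≫ H.functor.map (ε G.functor)) ≫ H.functor.map (G.functor.map (ε F.functor))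
      simp)
    (by
      ext x y
      change μ H.functor _ _ ≫ H.functor.map (μ G.functor _ _ ≫ G.functor.map (μ F.functor x y)) =
        (μ H.functor _ _ ≫ H.functor.map (μ G.functor _ _)) ≫
          H.functor.map (G.functor.map (μ F.functor x y))
      simp)
    (fun x => by
      change H.functor.map (G.functor.map (F.phi.hom.app x) ≫ G.phi.hom.app _) ≫ H.phi.hom.app _ =
        H.functor.map (G.functor.map (F.phi.hom.app x)) ≫
          H.functor.map (G.phi.hom.app _) ≫ H.phi.hom.app _
      simp)

instance strict : Bicategory.Strict (AICat.{v, u} k) where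
  id_comp := id_comp'
  comp_id := comp_id'
  assoc := assoc'
  leftUnitor_eqToIso F := Iso.ext (hom₂_ext fun x => (eqToIso_app (id_comp' F) x).symm)
  rightUnitor_eqToIso F := Iso.ext (hom₂_ext fun x => (eqToIso_app (comp_id' F) x).symm)
  associator_eqToIso F G H := Iso.ext (hom₂_ext fun x => (eqToIso_app (assoc' F G H) x).symm)

end AICat

/-! ### The 2-category of (braided, symmetric) monoidal dagger categories -/

lemma IsUnitary.id {C : Type u} [Category.{v} C] [DaggerCategory C] (X : C) :
    IsUnitary (𝟙 X) := by
  simp [IsUnitary, dag_id]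

lemma IsUnitary.comp {C : Type u} [Category.{v} C] [DaggerCategory C] {X Y Z : C} {f : X ⟶ Y}
    {g : Y ⟶ Z} (hf : IsUnitary f) (hg : IsUnitary g) : IsUnitary (f ≫ g) := by
  obtain ⟨hf₁, hf₂⟩ := hf
  obtain ⟨hg₁, hg₂⟩ := hg
  constructor
  · rw [dag_comp, Category.assoc, reassoc_of% hg₁, hf₁]
  · rw [dag_comp, Category.assoc, reassoc_of% hf₂, hg₂]

/-- A (braided, symmetric) monoidal dagger category. -/
structure DagCat (k : Level) where
  carrier : Type u
  [category : Category.{v} carrier]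
  [monoidal : MonoidalCategory carrier]
  [dagger : DaggerCategory carrier]
  [monoidalDagger : MonoidalDagger carrier]
  braiding : BraidingData k carrier
  isUnitary : braiding.IsUnitary

attribute [instance] DagCat.category DagCat.monoidal DagCat.dagger DagCat.monoidalDagger

namespace DagCat

variable {k : Level}

/-- A (braided, symmetric) monoidal dagger functor. -/
structure Hom (X Y : DagCat.{v, u} k) where
  functor : X.carrier ⥤ Y.carrier
  [monoidal : functor.Monoidal]
  map_dag : ∀ {x y : X.carrier} (f : x ⟶ y), functor.map (dag f) = dag (functor.map f)
  unitary_unit : IsUnitary (Functor.LaxMonoidal.ε functor)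
  unitary_tensor : ∀ x y : X.carrier, IsUnitary (Functor.LaxMonoidal.μ functor x y)
  isBraided : X.braiding.IsPreservedBy Y.braiding functor

attribute [instance] Hom.monoidal

namespace Hom

lemma map_isUnitary {X Y : DagCat.{v, u} k} (F : Hom X Y) {x y : X.carrier} {f : x ⟶ y}
    (hf : IsUnitary f) : IsUnitary (F.functor.map f) := by
  obtain ⟨h₁, h₂⟩ := hf
  constructor
  · rw [← F.map_dag, ← F.functor.map_comp, h₁, F.functor.map_id]
  · rw [← F.map_dag, ← F.functor.map_comp, h₂, F.functor.map_id]

lemma mk_eq {X Y : DagCat.{v, u} k} {F : X.carrier ⥤ Y.carrier} {m m' : F.Monoidal}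
    {a a' b b' c c' d d'} (hε : m.ε = m'.ε) (hμ : m.μ = m'.μ) :
    (@Hom.mk k X Y F m a b c d) = (@Hom.mk k X Y F m' a' b' c' d') := by
  have h1 : m = m' := by
    apply Functor.Monoidal.toLaxMonoidal_injective
    exact Functor.LaxMonoidal.ext hε hμ
  subst h1
  rfl

/-- The identity. -/
@[simps functor]
def id (X : DagCat.{v, u} k) : Hom X X where
  functor := 𝟭 _
  map_dag _ := rfl
  unitary_unit := IsUnitary.id _
  unitary_tensor _ _ := IsUnitary.id _
  isBraided := BraidingData.isPreservedBy_id _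

/-- Composition. -/
@[simps functor]
def comp {X Y Z : DagCat.{v, u} k} (F : Hom X Y) (G : Hom Y Z) : Hom X Z where
  functor := F.functor ⋙ G.functor
  map_dag f := by rw [Functor.comp_map, F.map_dag, G.map_dag, Functor.comp_map]
  unitary_unit := IsUnitary.comp G.unitary_unit (G.map_isUnitary F.unitary_unit)
  unitary_tensor x y :=
    IsUnitary.comp (G.unitary_tensor _ _) (G.map_isUnitary (F.unitary_tensor x y))
  isBraided := BraidingData.isPreservedBy_comp F.isBraided G.isBraided

end Hom

/-- A (braided, symmetric) monoidal isometric natural transformation. -/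
structure Hom₂ {X Y : DagCat.{v, u} k} (F G : Hom X Y) where
  toNatTrans : F.functor ⟶ G.functor
  isMonoidal : NatTrans.IsMonoidal toNatTrans
  isometric : ∀ x : X.carrier, IsIsometry (toNatTrans.app x)

instance : CategoryStruct (DagCat.{v, u} k) where
  Hom := Hom
  id := Hom.id
  comp := Hom.comp

@[simp] lemma id_functor (X : DagCat.{v, u} k) : Hom.functor (𝟙 X) = 𝟭 X.carrier := rfl

@[simp] lemma comp_functor {X Y Z : DagCat.{v, u} k} (F : X ⟶ Y) (G : Y ⟶ Z) :
    (F ≫ G).functor = F.functor ⋙ G.functor := rfl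

instance homCategory (X Y : DagCat.{v, u} k) : Category (X ⟶ Y) where
  Hom F G := Hom₂ F G
  id F :=
    { toNatTrans := 𝟙 F.functor
      isMonoidal := inferInstance
      isometric := fun x => (IsUnitary.id _).1 }
  comp {F G H} σ τ :=
    { toNatTrans := σ.toNatTrans ≫ τ.toNatTrans
      isMonoidal := by
        have := σ.isMonoidal
        have := τ.isMonoidal
        infer_instance
      isometric := fun x => by
        have h1 := σ.isometric x
        have h2 := τ.isometric x
        unfold IsIsometry at *
        rw [NatTrans.comp_app, dag_comp, Category.assoc, reassoc_of% h2, h1] }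
  id_comp _ := by congr 1; exact Category.id_comp _
  comp_id _ := by congr 1; exact Category.comp_id _
  assoc _ _ _ := by congr 1; exact Category.assoc _ _ _

lemma hom₂_ext {X Y : DagCat.{v, u} k} {F G : X ⟶ Y} {σ τ : F ⟶ G}
    (h : ∀ x, σ.toNatTrans.app x = τ.toNatTrans.app x) : σ = τ := by
  obtain ⟨s, hs, hs'⟩ := σ
  obtain ⟨t, ht, ht'⟩ := τ
  obtain rfl : s = t := NatTrans.ext (funext h)
  rfl

@[simp] lemma id_app {X Y : DagCat.{v, u} k} (F : X ⟶ Y) (x : X.carrier) :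
    (Hom₂.toNatTrans (𝟙 F)).app x = 𝟙 (F.functor.obj x) := rfl

@[simp] lemma comp_app {X Y : DagCat.{v, u} k} {F G H : X ⟶ Y} (σ : F ⟶ G) (τ : G ⟶ H)
    (x : X.carrier) :
    (σ ≫ τ).toNatTrans.app x = σ.toNatTrans.app x ≫ τ.toNatTrans.app x := rfl

/-- An invertible 2-morphism from a monoidal natural isomorphism with isometric components. -/
def isoMk {X Y : DagCat.{v, u} k} (F G : X ⟶ Y) (e : F.functor ≅ G.functor)
    (h₁ : NatTrans.IsMonoidal e.hom) (h₂ : ∀ x : X.carrier, IsIsometry (e.hom.app x)) :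
    F ≅ G where
  hom := ⟨e.hom, h₁, h₂⟩
  inv := ⟨e.inv, inferInstance, fun x => by
    have h3 : e.inv.app x = dag (e.hom.app x) := by
      have := h₂ x
      unfold IsIsometry at this
      rw [← cancel_epi (e.hom.app x), this, Iso.hom_inv_id_app]
    unfold IsIsometry
    rw [h3, dag_dag, ← h3, Iso.inv_hom_id_app]⟩
  hom_inv_id := hom₂_ext fun x => e.hom_inv_id_app x
  inv_hom_id := hom₂_ext fun x => e.inv_hom_id_app x

instance bicategory : Bicategory (DagCat.{v, u} k) where
  homCategory := homCategory
  whiskerLeft {X Y Z} F {G H} τ :=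
    { toNatTrans := Functor.whiskerLeft F.functor τ.toNatTrans
      isMonoidal := by
        have := τ.isMonoidal
        change NatTrans.IsMonoidal (Functor.whiskerLeft F.functor τ.toNatTrans)
        infer_instance
      isometric := fun x => τ.isometric (F.functor.obj x) }
  whiskerRight {X Y Z} {F G} τ H :=
    { toNatTrans := Functor.whiskerRight τ.toNatTrans H.functor
      isMonoidal := by
        have := τ.isMonoidal
        change NatTrans.IsMonoidal (Functor.whiskerRight τ.toNatTrans H.functor)
        infer_instance
      isometric := fun x => by
        have h : τ.toNatTrans.app x ≫ dag (τ.toNatTrans.app x) = 𝟙 _ := τ.isometric x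
        change H.functor.map (τ.toNatTrans.app x) ≫ dag (H.functor.map (τ.toNatTrans.app x)) = 𝟙 _
        rw [← H.map_dag, ← H.functor.map_comp, h, H.functor.map_id] }
  associator F G H := isoMk _ _ (Functor.associator F.functor G.functor H.functor)
    (inferInstanceAs (NatTrans.IsMonoidal
      (Functor.associator F.functor G.functor H.functor).hom)) (fun x => (IsUnitary.id _).1)
  leftUnitor F := isoMk _ _ (Functor.leftUnitor F.functor)
    (inferInstanceAs (NatTrans.IsMonoidal (Functor.leftUnitor F.functor).hom))
    (fun x => (IsUnitary.id _).1)
  rightUnitor F := isoMk _ _ (Functor.rightUnitor F.functor)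
    (inferInstanceAs (NatTrans.IsMonoidal (Functor.rightUnitor F.functor).hom))
    (fun x => (IsUnitary.id _).1)
  whiskerLeft_id _ _ := hom₂_ext fun x => by simp
  whiskerLeft_comp _ _ _ _ _ _ := hom₂_ext fun x => by simp
  id_whiskerLeft _ := hom₂_ext fun x =>
    ((Category.id_comp _).trans (Category.comp_id _)).symm
  comp_whiskerLeft _ _ _ _ _ := hom₂_ext fun x =>
    ((Category.id_comp _).trans (Category.comp_id _)).symm
  id_whiskerRight _ _ := hom₂_ext fun x => by simp
  comp_whiskerRight _ _ _ := hom₂_ext fun x => by simp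
  whiskerRight_id _ := hom₂_ext fun x =>
    ((Category.id_comp _).trans (Category.comp_id _)).symm
  whiskerRight_comp _ _ _ := hom₂_ext fun x =>
    ((Category.id_comp _).trans (Category.comp_id _)).symm
  whisker_assoc _ _ _ _ _ := hom₂_ext fun x =>
    ((Category.id_comp _).trans (Category.comp_id _)).symm
  whisker_exchange _ _ := hom₂_ext fun x => by simp
  pentagon _ _ _ K := hom₂_ext fun x => by
    change K.functor.map (𝟙 _) ≫ 𝟙 _ ≫ 𝟙 _ = 𝟙 _ ≫ 𝟙 _
    simp
  triangle _ G := hom₂_ext fun x => by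
    change 𝟙 _ ≫ 𝟙 _ = G.functor.map (𝟙 _)
    simp

lemma eqToIso_app {X Y : DagCat.{v, u} k} {F G : X ⟶ Y} (h : F = G) (x : X.carrier) :
    (Hom₂.toNatTrans (eqToIso h).hom).app x =
      eqToHom (congrArg (fun K : Hom X Y => K.functor.obj x) h) := by
  subst h
  rfl

open Functor.LaxMonoidal in
lemma id_comp' {X Y : DagCat.{v, u} k} (F : X ⟶ Y) : 𝟙 X ≫ F = F := Hom.mk_eq
  (by change ε F.functor ≫ F.functor.map (𝟙 _) = ε F.functor; simp)
  (by ext x y; change μ F.functor x y ≫ F.functor.map (𝟙 _) = μ F.functor x y; simp)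

open Functor.LaxMonoidal in
lemma comp_id' {X Y : DagCat.{v, u} k} (F : X ⟶ Y) : F ≫ 𝟙 Y = F := Hom.mk_eq
  (by change 𝟙 _ ≫ ε F.functor = ε F.functor; simp)
  (by ext x y; change 𝟙 _ ≫ μ F.functor x y = μ F.functor x y; simp)

open Functor.LaxMonoidal in
lemma assoc' {W X Y Z : DagCat.{v, u} k} (F : W ⟶ X) (G : X ⟶ Y) (H : Y ⟶ Z) :
    (F ≫ G) ≫ H = F ≫ G ≫ H := Hom.mk_eq
  (by
    change ε H.functor ≫ H.functor.map (ε G.functor ≫ G.functor.map (ε F.functor)) =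
      (ε H.functor ≫ H.functor.map (ε G.functor)) ≫ H.functor.map (G.functor.map (ε F.functor))
    simp)
  (by
    ext x y
    change μ H.functor _ _ ≫ H.functor.map (μ G.functor _ _ ≫ G.functor.map (μ F.functor x y)) =
      (μ H.functor _ _ ≫ H.functor.map (μ G.functor _ _)) ≫
        H.functor.map (G.functor.map (μ F.functor x y))
    simp)

instance strict : Bicategory.Strict (DagCat.{v, u} k) where
  id_comp := id_comp'
  comp_id := comp_id'
  assoc := assoc'
  leftUnitor_eqToIso F := Iso.ext (hom₂_ext fun x => (eqToIso_app (id_comp' F) x).symm)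
  rightUnitor_eqToIso F := Iso.ext (hom₂_ext fun x => (eqToIso_app (comp_id' F) x).symm)
  associator_eqToIso F G H := Iso.ext (hom₂_ext fun x => (eqToIso_app (assoc' F G H) x).symm)

end DagCat

/-! ### The canonical 2-functor from dagger categories to anti-involutive categories -/

section

variable (C : Type u) [Category.{v} C] [DaggerCategory C]

/-- A dagger, as a functor `Cᵒᵖ ⥤ C`. -/
@[simps]
def dagFunctor : Cᵒᵖ ⥤ C where
  obj X := X.unop
  map f := dag f.unop
  map_id X := dag_id X.unop
  map_comp f g := dag_comp g.unop f.unop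

/-- A dagger category regarded as an anti-involutive category with `d = †` and `η = id`. -/
abbrev dagAntiInvolution : AntiInvolution C where
  d := dagFunctor C
  eta := NatIso.ofComponents (fun X => Iso.refl X) (fun {X Y} f => by
    change f ≫ 𝟙 Y = 𝟙 X ≫ dag (dag f)
    rw [dag_dag, Category.comp_id, Category.id_comp])
  eta_d c := by
    change 𝟙 c ≫ dag (𝟙 c) = 𝟙 c
    rw [dag_id, Category.comp_id]

lemma isUnitary_iff_dag_eq_inv {C : Type u} [Category.{v} C] [DaggerCategory C] {X Y : C}
    (e : X ≅ Y) : IsUnitary e.hom ↔ dag e.hom = e.inv := by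
  constructor
  · intro h
    rw [← cancel_epi e.hom, h.1, Iso.hom_inv_id]
  · intro h
    constructor
    · rw [h, Iso.hom_inv_id]
    · rw [h, Iso.inv_hom_id]

variable [MonoidalCategory C] [MonoidalDagger C]

/-- The identity monoidal structure on the dagger functor. -/
instance dagFunctorMonoidal : (dagFunctor C).Monoidal :=
  Functor.CoreMonoidal.toMonoidal
    { εIso := Iso.refl (𝟙_ C)
      μIso := fun X Y => Iso.refl (X.unop ⊗ Y.unop)
      μIso_hom_natural_left := fun {X Y} f Z => by
        change (dag f.unop ▷ Z.unop) ≫ 𝟙 _ = 𝟙 _ ≫ dag (f.unop ▷ Z.unop)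
        rw [← tensorHom_id, ← tensorHom_id, MonoidalDagger.dag_tensorHom, dag_id,
          Category.id_comp, Category.comp_id]
      μIso_hom_natural_right := fun {X Y} Z f => by
        change (Z.unop ◁ dag f.unop) ≫ 𝟙 _ = 𝟙 _ ≫ dag (Z.unop ◁ f.unop)
        rw [← id_tensorHom, ← id_tensorHom, MonoidalDagger.dag_tensorHom, dag_id,
          Category.id_comp, Category.comp_id]
      associativity := fun X Y Z => by
        change (𝟙 _ ▷ Z.unop) ≫ 𝟙 _ ≫ dag (α_ X.unop Y.unop Z.unop).inv =
          (α_ X.unop Y.unop Z.unop).hom ≫ (X.unop ◁ 𝟙 _) ≫ 𝟙 _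
        have h := (isUnitary_iff_dag_eq_inv _).1
          (MonoidalDagger.unitary_associator X.unop Y.unop Z.unop)
        rw [← h, dag_dag]
        simp
      left_unitality := fun X => by
        change (λ_ X.unop).hom = (𝟙 _ ▷ X.unop) ≫ 𝟙 _ ≫ dag (λ_ X.unop).inv
        have h := (isUnitary_iff_dag_eq_inv _).1 (MonoidalDagger.unitary_leftUnitor X.unop)
        rw [← h, dag_dag]
        simp
      right_unitality := fun X => by
        change (ρ_ X.unop).hom = (X.unop ◁ 𝟙 _) ≫ 𝟙 _ ≫ dag (ρ_ X.unop).inv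
        have h := (isUnitary_iff_dag_eq_inv _).1 (MonoidalDagger.unitary_rightUnitor X.unop)
        rw [← h, dag_dag]
        simp }

/-- A monoidal dagger category regarded as a monoidal anti-involutive category with trivial
coherence data `η`, `χ` and `u`. -/
abbrev dagMonoidalAntiInvolution : MonoidalAntiInvolution C where
  toAntiInvolution := dagAntiInvolution C
  monoidal := dagFunctorMonoidal C
  eta_unit := by
    change 𝟙 _ ≫ dag (𝟙 _) = 𝟙 _
    rw [dag_id, Category.comp_id]
  eta_tensor X Y := by
    change 𝟙 _ ≫ dag (𝟙 _) = (𝟙 X ⊗ₘ 𝟙 Y) ≫ 𝟙 _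
    rw [dag_id, Category.comp_id, Category.comp_id, id_tensorHom_id]

end

/-- The canonical 2-functor on objects. -/
def canonicalObj {k : Level} (D : DagCat.{v, u} k) : AICat.{v, u} k :=
  letI := dagMonoidalAntiInvolution D.carrier
  { carrier := D.carrier
    braiding := D.braiding
    isBraided := fun hk X Y => by
      change 𝟙 _ ≫ dag (D.braiding.beta hk X Y).inv = (D.braiding.beta hk X Y).hom ≫ 𝟙 _
      have h := (isUnitary_iff_dag_eq_inv _).1 (D.isUnitary hk X Y)
      rw [← h, dag_dag, Category.id_comp, Category.comp_id] }

/-- The canonical 2-functor on 1-morphisms: the comparison isomorphism `φ` is the identity. -/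
def canonicalMap {k : Level} {D E : DagCat.{v, u} k} (F : D ⟶ E) :
    canonicalObj D ⟶ canonicalObj E :=
  { functor := F.functor
    monoidal := F.monoidal
    phi := NatIso.ofComponents (fun X => Iso.refl (F.functor.obj X.unop)) (fun f =>
      (Category.comp_id _).trans ((F.map_dag f.unop).trans (Category.id_comp _).symm))
    phi_eta := fun x =>
      ((Category.comp_id _).trans (F.functor.map_id x)).trans
        ((Category.id_comp _).trans (dag_id _)).symm
    phi_unit := by
      change Functor.LaxMonoidal.ε F.functor ≫ F.functor.map (𝟙 _) ≫ 𝟙 _ ≫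
        dag (Functor.LaxMonoidal.ε F.functor) = 𝟙 _
      rw [F.functor.map_id, Category.id_comp, Category.id_comp, F.unitary_unit.1]
    phi_tensor := fun x y => by
      change (𝟙 _ ⊗ₘ 𝟙 _) ≫ 𝟙 _ = Functor.LaxMonoidal.μ F.functor x y ≫ F.functor.map (𝟙 _) ≫ 𝟙 _ ≫
        dag (Functor.LaxMonoidal.μ F.functor x y)
      rw [F.functor.map_id, Category.id_comp, Category.id_comp, (F.unitary_tensor x y).1,
        id_tensorHom_id, Category.id_comp]
    isBraided := F.isBraided }

/-- The canonical 2-functor on 2-morphisms. -/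
def canonicalMap₂ {k : Level} {D E : DagCat.{v, u} k} {F G : D ⟶ E} (τ : F ⟶ G) :
    canonicalMap F ⟶ canonicalMap G :=
  { toNatTrans := τ.toNatTrans
    isMonoidal := τ.isMonoidal
    antiInvolutive := fun x => by
      have h : τ.toNatTrans.app x ≫ dag (τ.toNatTrans.app x) = 𝟙 _ := τ.isometric x
      change 𝟙 _ = τ.toNatTrans.app x ≫ 𝟙 _ ≫ dag (τ.toNatTrans.app x)
      rw [Category.id_comp, h] }

lemma canonical_map_comp {k : Level} {D E E' : DagCat.{v, u} k} (F : D ⟶ E) (G : E ⟶ E') :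
    canonicalMap (F ≫ G) = canonicalMap F ≫ canonicalMap G :=
  AICat.Hom.mk_eq rfl rfl (fun x =>
    ((Category.comp_id _).trans (G.functor.map_id (F.functor.obj x.unop))).symm)

lemma whisker_aux {C : Type u} [Category.{v} C] {X Y : C} {f : X ⟶ X} {g : Y ⟶ Y} (hf : f = 𝟙 X)
    (hg : g = 𝟙 Y) (h : X ⟶ Y) : h = f ≫ h ≫ g := by
  rw [hf, hg, Category.id_comp, Category.comp_id]

/-- The canonical 2-functor from (braided, symmetric) monoidal dagger categories to (braided,
symmetric) monoidal anti-involutive categories. -/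
def canonical (k : Level) : StrictPseudofunctor (DagCat.{v, u} k) (AICat.{v, u} k) :=
  StrictPseudofunctor.mk''
    { obj := canonicalObj
      map := canonicalMap
      map₂ := canonicalMap₂
      map₂_id := fun _ => rfl
      map₂_comp := fun _ _ => rfl
      map_id := fun X => AICat.Hom.mk_eq rfl rfl (fun x => rfl)
      map_comp := canonical_map_comp
      map₂_whisker_left := fun {_ _ _} F {G H} τ => AICat.hom₂_ext fun x =>
        (whisker_aux (AICat.eqToHom_app (canonical_map_comp F G) x)
          (AICat.eqToHom_app (canonical_map_comp F H).symm x) (τ.toNatTrans.app (F.functor.obj x)))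
      map₂_whisker_right := fun {_ _ _ F G} τ H => AICat.hom₂_ext fun x =>
        (whisker_aux (AICat.eqToHom_app (canonical_map_comp F H) x)
          (AICat.eqToHom_app (canonical_map_comp G H).symm x)
          (H.functor.map (τ.toNatTrans.app x))) }

/-! ### The Hermitian completion on objects, 1-morphisms and 2-morphisms -/

/-- The Hermitian completion of a (braided, symmetric) monoidal anti-involutive category, with its
structure of a (braided, symmetric) monoidal dagger category. -/
def hermObj {k : Level} (X : AICat.{v, u} k) : DagCat.{v, max u v} k where
  carrier := Herm X.carrier
  braiding := Herm.braidingData X.braiding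
  isUnitary := Herm.braidingData_isUnitary X.isBraided

section

variable {k : Level} {X Y : AICat.{v, u} k} (F : AICat.Hom X Y)

/-- The Hermitian pairing `φ ∘ F h` on `F c` induced by a Hermitian pairing `h` on `c`. -/
@[simps]
def hermFunctorObj (x : Herm X.carrier) : Herm Y.carrier where
  obj := F.functor.obj x.obj
  pairing := F.functor.mapIso x.pairing ≪≫ F.phiApp x.obj
  hermitian := by
    change etaApp (F.functor.obj x.obj) ≫
      dMap (F.functor.map x.pairing.hom ≫ (F.phiApp x.obj).hom) =
      F.functor.map x.pairing.hom ≫ (F.phiApp x.obj).hom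
    have h1 : F.functor.map (etaApp x.obj) ≫ (F.phiApp (dObj x.obj)).hom =
      etaApp (F.functor.obj x.obj) ≫ dMap (F.phiApp x.obj).hom := F.phi_eta x.obj
    have h2 := F.phi_natural x.pairing.hom
    rw [dMap_comp, ← reassoc_of% h1, ← h2, ← F.functor.map_comp_assoc, x.pairing_dMap]

/-- The functor between Hermitian completions induced by an anti-involutive functor. -/
@[simps]
def hermFunctor : Herm X.carrier ⥤ Herm Y.carrier where
  obj := hermFunctorObj F
  map f := ⟨F.functor.map f.hom⟩
  map_id x := Herm.hom_ext (F.functor.map_id x.obj)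
  map_comp f g := Herm.hom_ext (F.functor.map_comp f.hom g.hom)

/-- The monoidal structure on the induced functor is that of the underlying functor. -/
instance hermFunctorMonoidal : (hermFunctor F).Monoidal :=
  Functor.CoreMonoidal.toMonoidal
    { εIso := Herm.isoMk (Functor.Monoidal.εIso F.functor)
      μIso := fun x y => Herm.isoMk (Functor.Monoidal.μIso F.functor x.obj y.obj)
      μIso_hom_natural_left := fun f z =>
        Herm.hom_ext (Functor.LaxMonoidal.μ_natural_left F.functor f.hom z.obj)
      μIso_hom_natural_right := fun z f =>
        Herm.hom_ext (Functor.LaxMonoidal.μ_natural_right F.functor z.obj f.hom)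
      associativity := fun x y z =>
        Herm.hom_ext (Functor.LaxMonoidal.associativity F.functor x.obj y.obj z.obj)
      left_unitality := fun x =>
        Herm.hom_ext (Functor.LaxMonoidal.left_unitality F.functor x.obj)
      right_unitality := fun x =>
        Herm.hom_ext (Functor.LaxMonoidal.right_unitality F.functor x.obj) }

lemma hermFunctor_unitary_tensor (x y : Herm X.carrier) :
    IsUnitary (Functor.LaxMonoidal.μ (hermFunctor F) x y) :=
  (Herm.isUnitary_iff_of_iso (Functor.Monoidal.μIso (hermFunctor F) x y)).2 (by
    have h : ((F.phiApp x.obj).hom ⊗ₘ (F.phiApp y.obj).hom) ≫ _ =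
      _ ≫ _ ≫ (F.phiApp (x.obj ⊗ y.obj)).hom ≫ _ := F.phi_tensor x.obj y.obj
    change Functor.LaxMonoidal.μ F.functor x.obj y.obj ≫
      (F.functor.map ((x.pairing.hom ⊗ₘ y.pairing.hom) ≫ (chi x.obj y.obj).hom) ≫
        (F.phiApp (x.obj ⊗ y.obj)).hom) ≫ dMap (Functor.LaxMonoidal.μ F.functor x.obj y.obj) =
      ((F.functor.map x.pairing.hom ≫ (F.phiApp x.obj).hom) ⊗ₘ
        (F.functor.map y.pairing.hom ≫ (F.phiApp y.obj).hom)) ≫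
        (chi (F.functor.obj x.obj) (F.functor.obj y.obj)).hom
    rw [← tensorHom_comp_tensorHom, Category.assoc, Category.assoc, h, Functor.map_comp,
      Category.assoc, Functor.LaxMonoidal.μ_natural_assoc])

end

/-- The Hermitian completion on 1-morphisms. -/
def hermMap {k : Level} {X Y : AICat.{v, u} k} (F : X ⟶ Y) : hermObj X ⟶ hermObj Y :=
  { functor := hermFunctor F
    monoidal := hermFunctorMonoidal F
    map_dag := fun {x y} f => Herm.hom_ext (by
      change F.functor.map (y.pairing.hom ≫ dMap f.hom ≫ x.pairing.inv) =
        (F.functor.map y.pairing.hom ≫ (F.phiApp y.obj).hom) ≫ dMap (F.functor.map f.hom) ≫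
          (F.phiApp x.obj).inv ≫ F.functor.map x.pairing.inv
      have h := F.phi_natural f.hom
      rw [Category.assoc, ← reassoc_of% h, Iso.hom_inv_id_assoc, Functor.map_comp,
        Functor.map_comp])
    unitary_unit := (Herm.isUnitary_iff_of_iso
      (Functor.Monoidal.εIso (hermFunctor F))).2 (by
        have h := F.phi_unit
        change Functor.LaxMonoidal.ε F.functor ≫ (F.functor.map (uIso X.carrier).hom ≫
          F.phi.hom.app (op (𝟙_ X.carrier))) ≫ dMap (Functor.LaxMonoidal.ε F.functor) =
          (uIso Y.carrier).hom
        rw [Category.assoc, h])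
    unitary_tensor := hermFunctor_unitary_tensor F
    isBraided := fun hk x y => Herm.hom_ext (F.isBraided hk x.obj y.obj) }

/-- The Hermitian completion on 2-morphisms. -/
def hermMap₂ {k : Level} {X Y : AICat.{v, u} k} {F G : X ⟶ Y} (τ : F ⟶ G) :
    hermMap F ⟶ hermMap G :=
  { toNatTrans :=
      { app := fun x => ⟨τ.toNatTrans.app x.obj⟩
        naturality := fun _ _ f => Herm.hom_ext (τ.toNatTrans.naturality f.hom) }
    isMonoidal :=
      { unit := Herm.hom_ext τ.isMonoidal.unit
        tensor := fun x y => Herm.hom_ext (τ.isMonoidal.tensor x.obj y.obj) }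
    isometric := fun x => Herm.hom_ext (by
      have h := τ.antiInvolutive x.obj
      change τ.toNatTrans.app x.obj ≫ (G.functor.map x.pairing.hom ≫ (G.phiApp x.obj).hom) ≫
        dMap (τ.toNatTrans.app x.obj) ≫ (F.phiApp x.obj).inv ≫ F.functor.map x.pairing.inv = 𝟙 _
      rw [Category.assoc, ← NatTrans.naturality_assoc]
      have h2 : τ.toNatTrans.app (dObj x.obj) ≫ (G.phiApp x.obj).hom ≫
          dMap (τ.toNatTrans.app x.obj) ≫ (F.phiApp x.obj).inv = 𝟙 _ := by
        rw [← Iso.hom_inv_id (F.phiApp x.obj), h]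
        simp only [Category.assoc]
      have h3 := congrArg (fun t => F.functor.map x.pairing.hom ≫ t ≫
        F.functor.map x.pairing.inv) h2
      simp only [Category.assoc, Category.id_comp] at h3
      refine h3.trans ?_
      rw [← F.functor.map_comp, Iso.hom_inv_id, F.functor.map_id]) }

/-- The action of the Hermitian completion on objects, 1-morphisms and 2-morphisms. -/
def hermData (k : Level) : PrelaxFunctorStruct (AICat.{v, u} k) (DagCat.{v, max u v} k) where
  obj := hermObj
  map := hermMap
  map₂ := hermMap₂

/-! ### Monoidal positivity structures -/

/-- A (closed) monoidal positivity structure: a collection of Hermitian pairings such that every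
object carries one of them, closed under transfer along isomorphisms and under tensor products. -/
structure PositivityStructure (C : Type u) [Category.{v} C] [MonoidalCategory C]
    [MonoidalAntiInvolution C] where
  pos : ObjectProperty (Herm C)
  exists_pos : ∀ c : C, ∃ x : Herm C, pos x ∧ x.obj = c
  transfer_mem : ∀ x : Herm C, pos x → ∀ {c : C} (g : c ≅ x.obj), pos (x.transfer g)
  tensor_mem : ∀ x y : Herm C, pos x → pos y → pos (x ⊗ y)

/-- The canonical pairing of the monoidal unit is automatically positive. -/
lemma PositivityStructure.unit_mem {C : Type u} [Category.{v} C] [MonoidalCategory C]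
    [MonoidalAntiInvolution C] (P : PositivityStructure C) : P.pos (𝟙_ (Herm C)) := by
  obtain ⟨⟨c, h, hh⟩, hx, hc⟩ := P.exists_pos (𝟙_ C)
  dsimp only at hc
  subst hc
  let a : 𝟙_ C ≅ 𝟙_ C := h ≪≫ (uIso C).symm
  have ha : a.hom ≫ (uIso C).hom = h.hom := by
    change (h.hom ≫ (uIso C).inv) ≫ (uIso C).hom = h.hom
    rw [Category.assoc, Iso.inv_hom_id, Category.comp_id]
  have ha2 : (uIso C).hom ≫ dMap a.hom = a.hom ≫ (uIso C).hom := by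
    have h1 : etaApp (𝟙_ C) ≫ dMap h.hom = h.hom := hh
    rw [← ha, dMap_comp, reassoc_of% (etaApp_unit (C := C))] at h1
    exact h1
  have hm := P.transfer_mem _ (P.tensor_mem _ _ hx hx) (a.symm ≪≫ (λ_ (𝟙_ C)).symm)
  convert hm using 1
  refine Herm.ext rfl (heq_of_eq (Iso.ext ?_))
  change (uIso C).hom = (a.inv ≫ (λ_ (𝟙_ C)).inv) ≫ ((h.hom ⊗ₘ h.hom) ≫ (chi (𝟙_ C) (𝟙_ C)).hom) ≫
    dMap (a.inv ≫ (λ_ (𝟙_ C)).inv)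
  have e1 : (h.hom ⊗ₘ h.hom) = (a.hom ⊗ₘ h.hom) ≫ ((uIso C).hom ▷ dObj (𝟙_ C)) := by
    rw [← tensorHom_id, tensorHom_comp_tensorHom, Category.comp_id, ha]
  have e2 : (a.hom ⊗ₘ h.hom) ≫ (λ_ (dObj (𝟙_ C))).hom = (λ_ (𝟙_ C)).hom ≫ a.hom ≫ h.hom := by
    rw [MonoidalCategory.tensorHom_def, Category.assoc, leftUnitor_naturality, unitors_equal,
      rightUnitor_naturality_assoc]
  rw [dMap_comp, e1]
  simp only [Category.assoc]
  have e3 := chi_left_unitality (𝟙_ C)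
  rw [← reassoc_of% e3, reassoc_of% e2, Iso.inv_hom_id_assoc, Iso.inv_hom_id_assoc, ← ha,
    ← ha2, Category.assoc, ← dMap_comp, Iso.inv_hom_id, dMap_id, Category.comp_id]

instance {C : Type u} [Category.{v} C] [MonoidalCategory C] [MonoidalAntiInvolution C]
    (P : PositivityStructure C) : P.pos.IsMonoidal where
  prop_unit := P.unit_mem
  prop_tensor := P.tensor_mem

/-! ### Full dagger subcategories -/

section

variable {D : Type u} [Category.{v} D] [DaggerCategory D] (P : ObjectProperty D)

instance fullDagger : DaggerCategory P.FullSubcategory where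
  dag f := ObjectProperty.homMk (dag f.hom)
  dag_id X := ObjectProperty.hom_ext _ (dag_id X.obj)
  dag_comp f g := ObjectProperty.hom_ext _ (dag_comp f.hom g.hom)
  dag_dag f := ObjectProperty.hom_ext _ (dag_dag f.hom)

lemma full_isUnitary {X Y : P.FullSubcategory} {f : X ⟶ Y} (h : IsUnitary f.hom) :
    IsUnitary f :=
  ⟨ObjectProperty.hom_ext _ h.1, ObjectProperty.hom_ext _ h.2⟩

instance fullMonoidalDagger [MonoidalCategory D] [MonoidalDagger D] [P.IsMonoidal] :
    MonoidalDagger P.FullSubcategory where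
  dag_tensorHom f g := ObjectProperty.hom_ext _ (MonoidalDagger.dag_tensorHom f.hom g.hom)
  unitary_associator X Y Z :=
    full_isUnitary P (MonoidalDagger.unitary_associator X.obj Y.obj Z.obj)
  unitary_leftUnitor X := full_isUnitary P (MonoidalDagger.unitary_leftUnitor X.obj)
  unitary_rightUnitor X := full_isUnitary P (MonoidalDagger.unitary_rightUnitor X.obj)

end

namespace DagCat

variable {k : Level}

/-- The full dagger subcategory on a collection of objects containing the unit and closed under
tensor products. -/
def full (D : DagCat.{v, u} k) (P : ObjectProperty D.carrier) [P.IsMonoidal] :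
    DagCat.{v, u} k where
  carrier := P.FullSubcategory
  braiding :=
    { braiding := fun hk => letI := D.braiding.braiding hk; P.fullBraidedSubcategory
      symmetric := fun h hk X Y =>
        ObjectProperty.hom_ext _ (D.braiding.symmetric h hk X.obj Y.obj) }
  isUnitary := fun hk X Y => full_isUnitary P (D.isUnitary hk X.obj Y.obj)

/-- The restriction of a monoidal functor to full subcategories. -/
instance restrictMonoidal {C : Type u₁} [Category.{v₁} C] [MonoidalCategory C] {D : Type u₂}
    [Category.{v₂} D] [MonoidalCategory D] (P : ObjectProperty C) [P.IsMonoidal]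
    (Q : ObjectProperty D) [Q.IsMonoidal] (F : C ⥤ D) [F.Monoidal]
    (h : ∀ x : P.FullSubcategory, Q ((P.ι ⋙ F).obj x)) : (Q.lift (P.ι ⋙ F) h).Monoidal :=
  Functor.CoreMonoidal.toMonoidal
    { εIso := Q.isoMk (Functor.Monoidal.εIso F)
      μIso := fun x y => Q.isoMk (Functor.Monoidal.μIso F x.obj y.obj)
      μIso_hom_natural_left := fun f z => ObjectProperty.hom_ext _
        (Functor.LaxMonoidal.μ_natural_left F f.hom z.obj)
      μIso_hom_natural_right := fun z f => ObjectProperty.hom_ext _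
        (Functor.LaxMonoidal.μ_natural_right F z.obj f.hom)
      associativity := fun x y z => ObjectProperty.hom_ext _
        (Functor.LaxMonoidal.associativity F x.obj y.obj z.obj)
      left_unitality := fun x => ObjectProperty.hom_ext _
        (Functor.LaxMonoidal.left_unitality F x.obj)
      right_unitality := fun x => ObjectProperty.hom_ext _
        (Functor.LaxMonoidal.right_unitality F x.obj) }

/-- The restriction of a 1-morphism to full dagger subcategories. -/
def restrict {D E : DagCat.{v, u} k} (F : D ⟶ E) (P : ObjectProperty D.carrier) [P.IsMonoidal]
    (Q : ObjectProperty E.carrier) [Q.IsMonoidal] (h : ∀ x, P x → Q (F.functor.obj x)) :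
    D.full P ⟶ E.full Q :=
  { functor := Q.lift (P.ι ⋙ F.functor) (fun x => h x.obj x.property)
    monoidal := restrictMonoidal P Q F.functor (fun x => h x.obj x.property)
    map_dag := fun f => ObjectProperty.hom_ext _ (F.map_dag f.hom)
    unitary_unit := full_isUnitary Q F.unitary_unit
    unitary_tensor := fun x y => full_isUnitary Q (F.unitary_tensor x.obj y.obj)
    isBraided := fun hk x y => ObjectProperty.hom_ext _ (F.isBraided hk x.obj y.obj) }

/-- The restriction of a 2-morphism to full dagger subcategories. -/
def restrict₂ {D E : DagCat.{v, u} k} {F G : D ⟶ E} (τ : F ⟶ G) (P : ObjectProperty D.carrier)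
    [P.IsMonoidal] (Q : ObjectProperty E.carrier) [Q.IsMonoidal]
    (hF : ∀ x, P x → Q (F.functor.obj x)) (hG : ∀ x, P x → Q (G.functor.obj x)) :
    restrict F P Q hF ⟶ restrict G P Q hG :=
  { toNatTrans :=
      { app := fun x => ObjectProperty.homMk (τ.toNatTrans.app x.obj)
        naturality := fun _ _ f => ObjectProperty.hom_ext _ (τ.toNatTrans.naturality f.hom) }
    isMonoidal :=
      { unit := ObjectProperty.hom_ext _ τ.isMonoidal.unit
        tensor := fun x y => ObjectProperty.hom_ext _ (τ.isMonoidal.tensor x.obj y.obj) }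
    isometric := fun x => ObjectProperty.hom_ext _ (τ.isometric x.obj) }

end DagCat

/-! ### Anti-involutive categories with a positivity structure -/

/-- A (braided, symmetric) monoidal anti-involutive category equipped with a monoidal positivity
structure. -/
structure AIPosCat (k : Level) where
  toAICat : AICat.{v, u} k
  positivity : PositivityStructure toAICat.carrier

namespace AIPosCat

variable {k : Level}

/-- A 1-morphism: a (braided, symmetric) monoidal anti-involutive functor that sends positive
pairings to positive pairings. -/
structure Hom (X Y : AIPosCat.{v, u} k) where
  hom : X.toAICat ⟶ Y.toAICat
  preserves : ∀ x, X.positivity.pos x → Y.positivity.pos (hermFunctorObj hom x)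

/-- A 2-morphism: any 2-morphism of the underlying anti-involutive functors. -/
structure Hom₂ {X Y : AIPosCat.{v, u} k} (F G : Hom X Y) where
  hom : F.hom ⟶ G.hom

lemma hom_ext' {X Y : AIPosCat.{v, u} k} {F G : Hom X Y} (h : F.hom = G.hom) : F = G := by
  cases F
  cases G
  cases h
  rfl

lemma hermFunctorObj_id (X : AICat.{v, u} k) (x : Herm X.carrier) :
    hermFunctorObj (𝟙 X) x = x :=
  Herm.ext rfl (heq_of_eq (Iso.ext (Category.comp_id x.pairing.hom)))

lemma hermFunctorObj_comp {X Y Z : AICat.{v, u} k} (F : X ⟶ Y) (G : Y ⟶ Z)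
    (x : Herm X.carrier) :
    hermFunctorObj (F ≫ G) x = hermFunctorObj G (hermFunctorObj F x) :=
  Herm.ext rfl (heq_of_eq (Iso.ext (by
    change G.functor.map (F.functor.map x.pairing.hom) ≫ G.functor.map (F.phiApp x.obj).hom ≫
      (G.phiApp (F.functor.obj x.obj)).hom =
      G.functor.map (F.functor.map x.pairing.hom ≫ (F.phiApp x.obj).hom) ≫
        (G.phiApp (F.functor.obj x.obj)).hom
    rw [Functor.map_comp, Category.assoc])))

instance : CategoryStruct (AIPosCat.{v, u} k) where
  Hom := Hom
  id X := ⟨𝟙 X.toAICat, fun x hx => by rwa [hermFunctorObj_id]⟩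
  comp F G := ⟨F.hom ≫ G.hom, fun x hx => by
    rw [hermFunctorObj_comp]
    exact G.preserves _ (F.preserves x hx)⟩

instance homCategory (X Y : AIPosCat.{v, u} k) : Category (X ⟶ Y) where
  Hom F G := Hom₂ F G
  id F := ⟨𝟙 F.hom⟩
  comp σ τ := ⟨σ.hom ≫ τ.hom⟩
  id_comp _ := by congr 1; exact Category.id_comp _
  comp_id _ := by congr 1; exact Category.comp_id _
  assoc _ _ _ := by congr 1; exact Category.assoc _ _ _

lemma hom₂_ext {X Y : AIPosCat.{v, u} k} {F G : X ⟶ Y} {σ τ : F ⟶ G} (h : σ.hom = τ.hom) :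
    σ = τ := by
  obtain ⟨s⟩ := σ
  obtain ⟨t⟩ := τ
  obtain rfl : s = t := h
  rfl

/-- An invertible 2-morphism from one between the underlying 1-morphisms. -/
def isoMk {X Y : AIPosCat.{v, u} k} (F G : X ⟶ Y) (e : Hom.hom F ≅ Hom.hom G) : F ≅ G where
  hom := ⟨e.hom⟩
  inv := ⟨e.inv⟩
  hom_inv_id := hom₂_ext e.hom_inv_id
  inv_hom_id := hom₂_ext e.inv_hom_id

instance bicategory : Bicategory (AIPosCat.{v, u} k) where
  homCategory := homCategory
  whiskerLeft {_ _ _} F {_ _} τ := ⟨Bicategory.whiskerLeft F.hom τ.hom⟩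
  whiskerRight {_ _ _ _ _} τ H := ⟨Bicategory.whiskerRight τ.hom H.hom⟩
  associator F G H := isoMk _ _ (Bicategory.associator F.hom G.hom H.hom)
  leftUnitor F := isoMk _ _ (Bicategory.leftUnitor F.hom)
  rightUnitor F := isoMk _ _ (Bicategory.rightUnitor F.hom)
  whiskerLeft_id _ _ := hom₂_ext (Bicategory.whiskerLeft_id _ _)
  whiskerLeft_comp _ _ _ _ _ _ := hom₂_ext (Bicategory.whiskerLeft_comp _ _ _)
  id_whiskerLeft _ := hom₂_ext (Bicategory.id_whiskerLeft _)
  comp_whiskerLeft _ _ _ _ _ := hom₂_ext (Bicategory.comp_whiskerLeft _ _ _)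
  id_whiskerRight _ _ := hom₂_ext (Bicategory.id_whiskerRight _ _)
  comp_whiskerRight _ _ _ := hom₂_ext (Bicategory.comp_whiskerRight _ _ _)
  whiskerRight_id _ := hom₂_ext (Bicategory.whiskerRight_id _)
  whiskerRight_comp _ _ _ := hom₂_ext (Bicategory.whiskerRight_comp _ _ _)
  whisker_assoc _ _ _ _ _ := hom₂_ext (Bicategory.whisker_assoc _ _ _)
  whisker_exchange _ _ := hom₂_ext (Bicategory.whisker_exchange _ _)
  pentagon _ _ _ _ := hom₂_ext (Bicategory.pentagon _ _ _ _)
  triangle _ _ := hom₂_ext (Bicategory.triangle _ _)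

lemma eqToHom_hom {X Y : AIPosCat.{v, u} k} {F G : X ⟶ Y} (h : F = G) :
    Hom₂.hom (eqToHom h) = eqToHom (congrArg (fun K : Hom X Y => K.hom) h) := by
  subst h
  rfl

lemma eqToIso_hom_hom {X Y : AIPosCat.{v, u} k} {F G : X ⟶ Y} (h : F = G) :
    Hom₂.hom (eqToIso h).hom = (eqToIso (congrArg (fun K : Hom X Y => K.hom) h)).hom := by
  subst h
  rfl

lemma id_comp' {X Y : AIPosCat.{v, u} k} (F : X ⟶ Y) : 𝟙 X ≫ F = F :=
  hom_ext' (Bicategory.Strict.id_comp F.hom)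

lemma comp_id' {X Y : AIPosCat.{v, u} k} (F : X ⟶ Y) : F ≫ 𝟙 Y = F :=
  hom_ext' (Bicategory.Strict.comp_id F.hom)

lemma assoc' {W X Y Z : AIPosCat.{v, u} k} (F : W ⟶ X) (G : X ⟶ Y) (H : Y ⟶ Z) :
    (F ≫ G) ≫ H = F ≫ G ≫ H :=
  hom_ext' (Bicategory.Strict.assoc F.hom G.hom H.hom)

instance strict : Bicategory.Strict (AIPosCat.{v, u} k) where
  id_comp := id_comp'
  comp_id := comp_id'
  assoc := assoc'
  leftUnitor_eqToIso F := Iso.ext (hom₂_ext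
    ((congrArg Iso.hom (Bicategory.Strict.leftUnitor_eqToIso F.hom)).trans
      (eqToIso_hom_hom (id_comp' F)).symm))
  rightUnitor_eqToIso F := Iso.ext (hom₂_ext
    ((congrArg Iso.hom (Bicategory.Strict.rightUnitor_eqToIso F.hom)).trans
      (eqToIso_hom_hom (comp_id' F)).symm))
  associator_eqToIso F G H := Iso.ext (hom₂_ext
    ((congrArg Iso.hom (Bicategory.Strict.associator_eqToIso F.hom G.hom H.hom)).trans
      (eqToIso_hom_hom (assoc' F G H)).symm))

end AIPosCat

/-- The positive pairings, as a collection of objects of the Hermitian completion. -/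
def AIPosCat.positive {k : Level} (X : AIPosCat.{v, u} k) :
    ObjectProperty (hermObj X.toAICat).carrier :=
  X.positivity.pos

instance AIPosCat.positive_isMonoidal {k : Level} (X : AIPosCat.{v, u} k) :
    X.positive.IsMonoidal where
  prop_unit := X.positivity.unit_mem
  prop_tensor := X.positivity.tensor_mem

/-- The action of `(C, P) ↦ C_P` on objects, 1-morphisms and 2-morphisms, where `C_P` is the full
dagger subcategory of the Hermitian completion of `C` on the positive pairings. -/
def hermPosData (k : Level) :
    PrelaxFunctorStruct (AIPosCat.{v, u} k) (DagCat.{v, max u v} k) where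
  obj X := (hermObj X.toAICat).full X.positive
  map {X Y} F := DagCat.restrict (hermMap F.hom) X.positive Y.positive F.preserves
  map₂ {X Y F G} τ := DagCat.restrict₂ (hermMap₂ τ.hom) X.positive Y.positive
    F.preserves G.preserves

/-! ### The canonical positivity structure of a dagger category -/

section

variable {C : Type u} [Category.{v} C] [DaggerCategory C]

lemma IsIsoPositive.id (X : C) : IsIsoPositive (𝟙 X) :=
  ⟨X, Iso.refl X, by rw [Iso.refl_hom, dag_id, Category.comp_id]⟩

lemma IsIsoPositive.transfer {X Y : C} {f : X ⟶ X} (hf : IsIsoPositive f) (e : Y ≅ X) :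
    IsIsoPositive (e.hom ≫ f ≫ dag e.hom) := by
  obtain ⟨Z, g, rfl⟩ := hf
  refine ⟨Z, e ≪≫ g, ?_⟩
  rw [Iso.trans_hom, dag_comp]
  simp only [Category.assoc]

lemma IsIsoPositive.tensor [MonoidalCategory C] [MonoidalDagger C] {X Y : C} {f : X ⟶ X}
    {f' : Y ⟶ Y} (hf : IsIsoPositive f) (hf' : IsIsoPositive f') :
    IsIsoPositive ((f ⊗ₘ f') ≫ 𝟙 (X ⊗ Y)) := by
  obtain ⟨Z, g, rfl⟩ := hf
  obtain ⟨Z', g', rfl⟩ := hf'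
  refine ⟨Z ⊗ Z', MonoidalCategory.tensorIso g g', ?_⟩
  rw [MonoidalCategory.tensorIso_hom, MonoidalDagger.dag_tensorHom, tensorHom_comp_tensorHom,
    Category.comp_id]

end

lemma IsIsoPositive.map {k : Level} {D E : DagCat.{v, u} k} (F : D ⟶ E) {X : D.carrier}
    {f : X ⟶ X} (hf : IsIsoPositive f) :
    IsIsoPositive (F.functor.map f ≫ 𝟙 (F.functor.obj X)) := by
  obtain ⟨Z, g, rfl⟩ := hf
  refine ⟨F.functor.obj Z, F.functor.mapIso g, ?_⟩
  rw [F.functor.mapIso_hom, ← F.map_dag, ← F.functor.map_comp, Category.comp_id]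

/-- The positivity structure `Pos(D)` on a monoidal dagger category `D`, regarded as an
anti-involutive category: the pairings of the form `g† ∘ g` with `g` an isomorphism. -/
def canonicalPositivity {k : Level} (D : DagCat.{v, u} k) :
    PositivityStructure (canonicalObj D).carrier where
  pos x := IsIsoPositive (C := D.carrier) (X := x.obj) x.pairing.hom
  exists_pos c :=
    ⟨⟨c, Iso.refl (C := D.carrier) c, (Category.id_comp _).trans (dag_id (C := D.carrier) c)⟩,
      IsIsoPositive.id (C := D.carrier) c, rfl⟩
  transfer_mem _ hx _ e := IsIsoPositive.transfer (C := D.carrier) hx e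
  tensor_mem _ _ hx hx' := IsIsoPositive.tensor (C := D.carrier) hx hx'

lemma canonicalPositivity_map {k : Level} {D E : DagCat.{v, u} k} (F : D ⟶ E)
    (x : Herm (canonicalObj D).carrier) (hx : (canonicalPositivity D).pos x) :
    (canonicalPositivity E).pos (hermFunctorObj (canonicalMap F) x) :=
  IsIsoPositive.map F (X := x.obj) hx

lemma canonicalPos_eqToHom_app {k : Level} {D E : DagCat.{v, u} k}
    {F G : (⟨canonicalObj D, canonicalPositivity D⟩ : AIPosCat.{v, u} k) ⟶
      ⟨canonicalObj E, canonicalPositivity E⟩} (h : F = G) (x : D.carrier) :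
    (AIPosCat.Hom₂.hom (eqToHom h)).toNatTrans.app x =
      eqToHom (congrArg (fun K : AIPosCat.Hom _ _ => (AIPosCat.Hom.hom K).functor.obj x) h) := by
  subst h
  rfl

/-- The 2-functor `D ↦ (D, Pos(D))`, lifting the canonical 2-functor. -/
def canonicalPos (k : Level) : StrictPseudofunctor (DagCat.{v, u} k) (AIPosCat.{v, u} k) :=
  StrictPseudofunctor.mk''
    { obj := fun D => ⟨canonicalObj D, canonicalPositivity D⟩
      map := fun F => ⟨canonicalMap F, canonicalPositivity_map F⟩
      map₂ := fun τ => ⟨canonicalMap₂ τ⟩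
      map₂_id := fun _ => rfl
      map₂_comp := fun _ _ => rfl
      map_id := fun X => AIPosCat.hom_ext' ((canonical k).map_id X)
      map_comp := fun F G => AIPosCat.hom_ext' (canonical_map_comp F G)
      map₂_whisker_left := fun {_ _ _} F {G H} τ => AIPosCat.hom₂_ext (AICat.hom₂_ext fun x =>
        (whisker_aux (canonicalPos_eqToHom_app (AIPosCat.hom_ext' (canonical_map_comp F G)) x)
          (canonicalPos_eqToHom_app (AIPosCat.hom_ext' (canonical_map_comp F H).symm) x)
          (τ.toNatTrans.app (F.functor.obj x))))
      map₂_whisker_right := fun {_ _ _ F G} τ H => AIPosCat.hom₂_ext (AICat.hom₂_ext fun x =>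
        (whisker_aux (canonicalPos_eqToHom_app (AIPosCat.hom_ext' (canonical_map_comp F H)) x)
          (canonicalPos_eqToHom_app (AIPosCat.hom_ext' (canonical_map_comp G H).symm) x)
          (H.functor.map (τ.toNatTrans.app x)))) }

/-! ### Strict 2-natural transformations, strict 2-adjunctions, equivalences -/

section

universe w₁ w₂ v₃ v₄ u₃ u₄

variable {B : Type u₃} [Bicategory.{w₁, v₃} B] {C : Type u₄} [Bicategory.{w₂, v₄} C]

/-- A strict 2-natural transformation between strict 2-functors. -/
structure TwoNatTrans (F G : StrictPseudofunctor B C) where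
  app : ∀ X : B, F.obj X ⟶ G.obj X
  naturality : ∀ {X Y : B} (f : X ⟶ Y), F.map f ≫ app Y = app X ≫ G.map f
  naturality₂ : ∀ {X Y : B} {f g : X ⟶ Y} (η : f ⟶ g),
    Bicategory.whiskerRight (F.map₂ η) (app Y) ≫ eqToHom (naturality g) =
      eqToHom (naturality f) ≫ Bicategory.whiskerLeft (app X) (G.map₂ η)

/-- A strict 2-adjunction `L ⊣ R`: a unit and a counit which are strictly 2-natural and satisfy the
triangle identities on the nose. -/
structure TwoAdjunction (L : StrictPseudofunctor B C) (R : StrictPseudofunctor C B) where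
  unit : TwoNatTrans (StrictPseudofunctor.id B) (L.comp R)
  counit : TwoNatTrans (R.comp L) (StrictPseudofunctor.id C)
  left_triangle : ∀ X : B, L.map (unit.app X) ≫ counit.app (L.obj X) = 𝟙 (L.obj X)
  right_triangle : ∀ Y : C, unit.app (R.obj Y) ≫ R.map (counit.app Y) = 𝟙 (R.obj Y)

/-- A 1-morphism that is an (internal) equivalence. -/
def IsEquivalence {X Y : B} (f : X ⟶ Y) : Prop :=
  ∃ e : Bicategory.Equivalence X Y, e.hom = f

end

end DaggerHerm

/-!
An anti-involutive functor `(F, φ)` from a dagger category `D` to `C` equips every `F x` with the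
Hermitian pairing `φ_x`, and `φ` is natural precisely when the lifted functor `x ↦ (F x, φ_x)` into
`Herm C` preserves daggers. Hence the forgetful functor `Herm C ⥤ C`, anti-involutive with
comparison isomorphism `h` at `(c, h)`, is a strictly couniversal arrow from the canonical 2-functor
to `C`, and functoriality and the adjunction follow formally. With positivity structures, `C_P ⥤ C`
is couniversal in the same way: on `(D, Pos(D))` the pairing `φ_x` is the image of the positive
pairing `𝟙`.

The unit `D ⟶ D_{Pos(D)}` is an equivalence because an isomorphism `g : x ≅ z` is unitary from
`(x, g† ∘ g)` to `(z, 𝟙)`. The functor `C_P ⥤ C` is fully faithful and surjective on objects, hence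
an equivalence of anti-involutive categories, and it reflects positivity: if `h ∘ p` is a positive
pairing, then `p = g† ∘ g` for the identity of `c` regarded as a map `g : (c, h) ⟶ (c, h ∘ p)`.
-/

namespace DaggerHerm

open DaggerCategory (dag dag_id dag_comp dag_dag)

/-! ### Strict 2-adjunctions from couniversal arrows -/

section CouniversalArrows

universe w₁ w₂ v₃ v₄ u₃ u₄

open Bicategory

variable {B : Type u₃} [Bicategory.{w₁, v₃} B] {C : Type u₄} [Bicategory.{w₂, v₄} C]

section Strict

variable [Bicategory.Strict B]

lemma whiskerLeft_heq {a b c : B} {f f' : a ⟶ b} {g h g' h' : b ⟶ c} {η : g ⟶ h} {η' : g' ⟶ h'}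
    (hf : f = f') (hg : g = g') (hh : h = h') (hη : η ≍ η') : f ◁ η ≍ f' ◁ η' := by
  subst hf hg hh hη
  rfl

lemma whiskerRight_heq {a b c : B} {f g f' g' : a ⟶ b} {h h' : b ⟶ c} {η : f ⟶ g} {η' : f' ⟶ g'}
    (hf : f = f') (hg : g = g') (hh : h = h') (hη : η ≍ η') : η ▷ h ≍ η' ▷ h' := by
  subst hf hg hh hη
  rfl

lemma id_whiskerLeft_heq {a b : B} {f g : a ⟶ b} (η : f ⟶ g) : 𝟙 a ◁ η ≍ η := by
  simp only [Bicategory.id_whiskerLeft, Strict.leftUnitor_eqToIso, eqToIso.hom, eqToIso.inv,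
    eqToHom_comp_heq_iff, comp_eqToHom_heq_iff, heq_eq_eq]

lemma whiskerRight_id_heq {a b : B} {f g : a ⟶ b} (η : f ⟶ g) : η ▷ 𝟙 b ≍ η := by
  simp only [Bicategory.whiskerRight_id, Strict.rightUnitor_eqToIso, eqToIso.hom, eqToIso.inv,
    eqToHom_comp_heq_iff, comp_eqToHom_heq_iff, heq_eq_eq]

lemma comp_whiskerLeft_heq {a b c d : B} (f : a ⟶ b) (g : b ⟶ c) {h h' : c ⟶ d} (η : h ⟶ h') :
    (f ≫ g) ◁ η ≍ f ◁ g ◁ η := by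
  simp only [comp_whiskerLeft, Strict.associator_eqToIso, eqToIso.hom, eqToIso.inv,
    eqToHom_comp_heq_iff, comp_eqToHom_heq_iff, heq_eq_eq]

lemma whiskerRight_comp_heq {a b c d : B} {f f' : a ⟶ b} (η : f ⟶ f') (g : b ⟶ c) (h : c ⟶ d) :
    η ▷ (g ≫ h) ≍ (η ▷ g) ▷ h := by
  simp only [whiskerRight_comp, Strict.associator_eqToIso, eqToIso.hom, eqToIso.inv,
    eqToHom_comp_heq_iff, comp_eqToHom_heq_iff, heq_eq_eq]

lemma whisker_assoc_heq {a b c d : B} (f : a ⟶ b) {g g' : b ⟶ c} (η : g ⟶ g') (h : c ⟶ d) :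
    (f ◁ η) ▷ h ≍ f ◁ η ▷ h := by
  simp only [Bicategory.whisker_assoc, Strict.associator_eqToIso, eqToIso.hom, eqToIso.inv,
    eqToHom_comp_heq_iff, comp_eqToHom_heq_iff, heq_eq_eq]

end Strict

lemma map₂_whiskerLeft_heq (L : StrictPseudofunctor B C) {a b c : B} (f : a ⟶ b) {g h : b ⟶ c}
    (η : g ⟶ h) : L.map₂ (f ◁ η) ≍ L.map f ◁ L.map₂ η := by
  simp only [L.map₂_whisker_left, L.mapComp_eq_eqToIso, eqToIso.hom, eqToIso.inv,
    eqToHom_comp_heq_iff, comp_eqToHom_heq_iff, heq_eq_eq]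

lemma map₂_whiskerRight_heq (L : StrictPseudofunctor B C) {a b c : B} {f g : a ⟶ b} (η : f ⟶ g)
    (h : b ⟶ c) : L.map₂ (η ▷ h) ≍ L.map₂ η ▷ L.map h := by
  simp only [L.map₂_whisker_right, L.mapComp_eq_eqToIso, eqToIso.hom, eqToIso.inv,
    eqToHom_comp_heq_iff, comp_eqToHom_heq_iff, heq_eq_eq]

/-- Couniversal arrows `L (R Y) ⟶ Y` that exhibit `R` as a right 2-adjoint of `L`: they are strictly
natural for the assignments of `R` on 1- and 2-morphisms, every `L X ⟶ Y` factors through the arrow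
of `Y` by a unique `X ⟶ R Y`, and composition with the arrow is injective on 2-morphisms into `R Y`.
Functoriality of `R` is not assumed; it follows. -/
structure CouniversalArrows (L : StrictPseudofunctor B C) (R : PrelaxFunctorStruct C B) where
  arrow : ∀ Y : C, L.obj (R.obj Y) ⟶ Y
  naturality : ∀ {Y Z : C} (f : Y ⟶ Z), L.map (R.map f) ≫ arrow Z = arrow Y ≫ f
  naturality₂ : ∀ {Y Z : C} {f g : Y ⟶ Z} (τ : f ⟶ g),
    L.map₂ (R.map₂ τ) ▷ arrow Z ≍ arrow Y ◁ τ
  lift : ∀ {X : B} {Y : C}, (L.obj X ⟶ Y) → (X ⟶ R.obj Y)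
  lift_arrow : ∀ {X : B} {Y : C} (F : L.obj X ⟶ Y), L.map (lift F) ≫ arrow Y = F
  lift_map_arrow : ∀ {X : B} {Y : C} (F : X ⟶ R.obj Y), lift (L.map F ≫ arrow Y) = F
  hom₂_ext : ∀ {X : B} {Y : C} {F G : X ⟶ R.obj Y} {σ τ : F ⟶ G},
    L.map₂ σ ▷ arrow Y = L.map₂ τ ▷ arrow Y → σ = τ

namespace CouniversalArrows

variable {L : StrictPseudofunctor B C} {R : PrelaxFunctorStruct C B}

lemma hom_ext (A : CouniversalArrows L R) {X : B} {Y : C} {F G : X ⟶ R.obj Y}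
    (h : L.map F ≫ A.arrow Y = L.map G ≫ A.arrow Y) : F = G := by
  rw [← A.lift_map_arrow F, h, A.lift_map_arrow]

lemma hom₂_heq_ext (A : CouniversalArrows L R) {X : B} {Y : C} {F G F' G' : X ⟶ R.obj Y}
    {σ : F ⟶ G} {τ : F' ⟶ G'} (hF : F = F') (hG : G = G')
    (h : L.map₂ σ ▷ A.arrow Y ≍ L.map₂ τ ▷ A.arrow Y) : σ ≍ τ := by
  subst hF hG
  exact heq_of_eq (A.hom₂_ext (eq_of_heq h))

/-- The unit of the adjunction: the identity of `L X`, lifted along the couniversal arrow. -/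
def unit (A : CouniversalArrows L R) (X : B) : X ⟶ R.obj (L.obj X) :=
  A.lift (𝟙 (L.obj X))

lemma unit_arrow (A : CouniversalArrows L R) (X : B) :
    L.map (A.unit X) ≫ A.arrow (L.obj X) = 𝟙 (L.obj X) :=
  A.lift_arrow _

variable [Bicategory.Strict C]

lemma map_id (A : CouniversalArrows L R) (Y : C) : R.map (𝟙 Y) = 𝟙 (R.obj Y) :=
  A.hom_ext <| by rw [A.naturality, L.map_id, Strict.comp_id, Strict.id_comp]

lemma map_comp (A : CouniversalArrows L R) {X Y Z : C} (f : X ⟶ Y) (g : Y ⟶ Z) :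
    R.map (f ≫ g) = R.map f ≫ R.map g :=
  A.hom_ext <| by
    rw [A.naturality, L.map_comp, Strict.assoc, A.naturality, ← Strict.assoc, ← Strict.assoc,
      A.naturality]

lemma map₂_id (A : CouniversalArrows L R) {Y Z : C} (f : Y ⟶ Z) :
    R.map₂ (𝟙 f) = 𝟙 (R.map f) :=
  A.hom₂_ext <| eq_of_heq <| (A.naturality₂ _).trans <| by
    rw [Bicategory.whiskerLeft_id, L.map₂_id, Bicategory.id_whiskerRight, A.naturality]

lemma map₂_comp (A : CouniversalArrows L R) {Y Z : C} {f g h : Y ⟶ Z} (σ : f ⟶ g) (τ : g ⟶ h) :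
    R.map₂ (σ ≫ τ) = R.map₂ σ ≫ R.map₂ τ :=
  A.hom₂_ext <| eq_of_heq <| (A.naturality₂ _).trans <| by
    rw [Bicategory.whiskerLeft_comp, L.map₂_comp, Bicategory.comp_whiskerRight]
    exact heq_comp (A.naturality f).symm (A.naturality g).symm (A.naturality h).symm
      (A.naturality₂ σ).symm (A.naturality₂ τ).symm

protected lemma map₂_whiskerLeft_heq (A : CouniversalArrows L R) {X Y Z : C} (f : X ⟶ Y)
    {g h : Y ⟶ Z} (η : g ⟶ h) : R.map₂ (f ◁ η) ≍ R.map f ◁ R.map₂ η := by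
  have through_arrow : L.map₂ (R.map₂ (f ◁ η)) ▷ A.arrow Z ≍ (A.arrow X ≫ f) ◁ η :=
    (A.naturality₂ _).trans (comp_whiskerLeft_heq _ _ _).symm
  have back : L.map (R.map f) ◁ A.arrow Y ◁ η ≍ L.map (R.map f) ◁ L.map₂ (R.map₂ η) ▷ A.arrow Z :=
    whiskerLeft_heq rfl (A.naturality g).symm (A.naturality h).symm (A.naturality₂ η).symm
  have regroup : L.map (R.map f) ◁ L.map₂ (R.map₂ η) ▷ A.arrow Z ≍
      L.map₂ (R.map f ◁ R.map₂ η) ▷ A.arrow Z :=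
    (whisker_assoc_heq _ _ _).symm.trans <|
      whiskerRight_heq (L.map_comp _ _).symm (L.map_comp _ _).symm rfl
        (map₂_whiskerLeft_heq L _ _).symm
  rw [← A.naturality] at through_arrow
  exact A.hom₂_heq_ext (A.map_comp f g) (A.map_comp f h) <|
    through_arrow.trans <| (comp_whiskerLeft_heq _ _ _).trans <| back.trans regroup

protected lemma map₂_whiskerRight_heq (A : CouniversalArrows L R) {X Y Z : C} {f g : X ⟶ Y}
    (η : f ⟶ g) (h : Y ⟶ Z) : R.map₂ (η ▷ h) ≍ R.map₂ η ▷ R.map h := by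
  have through_arrow : L.map₂ (R.map₂ (η ▷ h)) ▷ A.arrow Z ≍ (A.arrow X ◁ η) ▷ h :=
    (A.naturality₂ _).trans (whisker_assoc_heq _ _ _).symm
  have back : (A.arrow X ◁ η) ▷ h ≍ L.map₂ (R.map₂ η) ▷ (A.arrow Y ≫ h) :=
    (whiskerRight_heq (A.naturality f).symm (A.naturality g).symm rfl (A.naturality₂ η).symm).trans
      (whiskerRight_comp_heq _ _ _).symm
  have regroup : L.map₂ (R.map₂ η) ▷ (L.map (R.map h) ≫ A.arrow Z) ≍
      L.map₂ (R.map₂ η ▷ R.map h) ▷ A.arrow Z :=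
    (whiskerRight_comp_heq _ _ _).trans <|
      whiskerRight_heq (L.map_comp _ _).symm (L.map_comp _ _).symm rfl
        (map₂_whiskerRight_heq L _ _).symm
  rw [A.naturality] at regroup
  exact A.hom₂_heq_ext (A.map_comp f h) (A.map_comp g h) <|
    through_arrow.trans <| back.trans regroup

lemma unit_naturality (A : CouniversalArrows L R) {X Y : B} (F : X ⟶ Y) :
    F ≫ A.unit Y = A.unit X ≫ R.map (L.map F) :=
  A.hom_ext <| by
    rw [L.map_comp, L.map_comp, Strict.assoc, Strict.assoc, A.naturality, A.unit_arrow,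
      ← Strict.assoc, A.unit_arrow, Strict.comp_id, Strict.id_comp]

lemma unit_map_arrow (A : CouniversalArrows L R) (Y : C) :
    A.unit (R.obj Y) ≫ R.map (A.arrow Y) = 𝟙 (R.obj Y) :=
  A.hom_ext <| by
    rw [L.map_comp, Strict.assoc, A.naturality, ← Strict.assoc, A.unit_arrow, L.map_id]

lemma unit_naturality₂ (A : CouniversalArrows L R) {X Y : B} {F G : X ⟶ Y} (σ : F ⟶ G) :
    σ ▷ A.unit Y ≍ A.unit X ◁ R.map₂ (L.map₂ σ) := by
  have left : L.map₂ (σ ▷ A.unit Y) ▷ A.arrow (L.obj Y) ≍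
      L.map₂ σ ▷ (L.map (A.unit Y) ≫ A.arrow (L.obj Y)) :=
    (whiskerRight_heq (L.map_comp _ _) (L.map_comp _ _) rfl
      (map₂_whiskerRight_heq L _ _)).trans (whiskerRight_comp_heq _ _ _).symm
  have right : L.map₂ (A.unit X ◁ R.map₂ (L.map₂ σ)) ▷ A.arrow (L.obj Y) ≍
      L.map (A.unit X) ◁ L.map₂ (R.map₂ (L.map₂ σ)) ▷ A.arrow (L.obj Y) :=
    (whiskerRight_heq (L.map_comp _ _) (L.map_comp _ _) rfl
      (map₂_whiskerLeft_heq L _ _)).trans (whisker_assoc_heq _ _ _)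
  have cancel : L.map (A.unit X) ◁ L.map₂ (R.map₂ (L.map₂ σ)) ▷ A.arrow (L.obj Y) ≍
      (L.map (A.unit X) ≫ A.arrow (L.obj X)) ◁ L.map₂ σ :=
    (whiskerLeft_heq rfl (A.naturality _) (A.naturality _) (A.naturality₂ _)).trans
      (comp_whiskerLeft_heq _ _ _).symm
  rw [A.unit_arrow] at left cancel
  exact A.hom₂_heq_ext (A.unit_naturality F) (A.unit_naturality G) <|
    left.trans <| (whiskerRight_id_heq _).trans <| (id_whiskerLeft_heq _).symm.trans <|
      cancel.symm.trans right.symm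

variable [Bicategory.Strict B]

/-- The strict 2-functor formed by the assignments of the right adjoint. -/
def rightAdjoint (A : CouniversalArrows L R) : StrictPseudofunctor C B :=
  StrictPseudofunctor.mk''
    { toPrelaxFunctorStruct := R
      map₂_id := A.map₂_id
      map₂_comp := A.map₂_comp
      map_id := A.map_id
      map_comp := A.map_comp
      map₂_whisker_left := fun f _ _ η =>
        (conj_eqToHom_iff_heq' _ _ _ _).2 (A.map₂_whiskerLeft_heq f η)
      map₂_whisker_right := fun η h =>
        (conj_eqToHom_iff_heq' _ _ _ _).2 (A.map₂_whiskerRight_heq η h) }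

/-- The strict 2-adjunction given by couniversal arrows, which are its counit. -/
def adjunction (A : CouniversalArrows L R) : TwoAdjunction L A.rightAdjoint where
  unit :=
    { app := A.unit
      naturality := A.unit_naturality
      naturality₂ := fun σ => eq_of_heq <| (comp_eqToHom_heq _ _).trans <|
        (A.unit_naturality₂ σ).trans (eqToHom_comp_heq _ _).symm }
  counit :=
    { app := fun Y => A.arrow Y
      naturality := A.naturality
      naturality₂ := fun τ => eq_of_heq <| (comp_eqToHom_heq _ _).trans <|
        (A.naturality₂ τ).trans (eqToHom_comp_heq _ _).symm }
  left_triangle := A.unit_arrow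
  right_triangle := A.unit_map_arrow

end CouniversalArrows

end CouniversalArrows

/-! ### The Hermitian completion as a right adjoint -/

lemma DagCat.hom_ext_heq {k : Level} {X Y : DagCat.{v, u} k} {F G : X ⟶ Y}
    (hobj : ∀ x, F.functor.obj x = G.functor.obj x)
    (hmap : ∀ {x y : X.carrier} (f : x ⟶ y), F.functor.map f ≍ G.functor.map f)
    (hε : Functor.LaxMonoidal.ε F.functor ≍ Functor.LaxMonoidal.ε G.functor)
    (hμ : ∀ x y, Functor.LaxMonoidal.μ F.functor x y ≍ Functor.LaxMonoidal.μ G.functor x y) :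
    F = G := by
  obtain ⟨F, _, _, _⟩ := F
  obtain ⟨G, _, _, _⟩ := G
  obtain rfl : F = G := Functor.hext hobj fun _ _ f => hmap f
  exact DagCat.Hom.mk_eq (eq_of_heq hε) (funext fun x => funext fun y => eq_of_heq (hμ x y))

namespace Herm

section

variable {C : Type u} [Category.{v} C] [AntiInvolution C]

lemma ext_pairing {c : C} {h h' : c ≅ dObj c} {hh : IsHermitian h} {hh' : IsHermitian h'}
    (e : h.hom = h'.hom) : (⟨c, h, hh⟩ : Herm C) = ⟨c, h', hh'⟩ :=
  Herm.ext rfl (heq_of_eq (Iso.ext e))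

lemma hom_heq {X X' Y Y' : Herm C} (hX : X = X') (hY : Y = Y') {f : X ⟶ Y} {g : X' ⟶ Y'}
    (h : f.hom ≍ g.hom) : f ≍ g := by
  subst hX hY
  exact heq_of_eq (hom_ext (eq_of_heq h))

lemma dag_hom_comp_pairing {X Y : Herm C} (f : X ⟶ Y) :
    (dag f).hom ≫ X.pairing.hom = Y.pairing.hom ≫ dMap f.hom := by
  rw [dag_hom, Category.assoc, Category.assoc, Iso.inv_hom_id, Category.comp_id]

end

instance forgetMonoidal {C : Type u} [Category.{v} C] [MonoidalCategory C]
    [MonoidalAntiInvolution C] : (forget C).Monoidal :=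
  Functor.CoreMonoidal.toMonoidal
    { εIso := Iso.refl (𝟙_ C)
      μIso := fun X Y => Iso.refl (X.obj ⊗ Y.obj)
      μIso_hom_natural_left := fun f Z => (Category.comp_id (f.hom ▷ Z.obj)).trans
        (Category.id_comp (f.hom ▷ Z.obj)).symm
      μIso_hom_natural_right := fun Z f => (Category.comp_id (Z.obj ◁ f.hom)).trans
        (Category.id_comp (Z.obj ◁ f.hom)).symm
      associativity := fun X Y Z => by
        change 𝟙 (X.obj ⊗ Y.obj) ▷ Z.obj ≫ 𝟙 ((X.obj ⊗ Y.obj) ⊗ Z.obj) ≫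
          (α_ X.obj Y.obj Z.obj).hom = (α_ X.obj Y.obj Z.obj).hom ≫
            X.obj ◁ 𝟙 (Y.obj ⊗ Z.obj) ≫ 𝟙 (X.obj ⊗ Y.obj ⊗ Z.obj)
        monoidal
      left_unitality := fun X => by
        change (λ_ X.obj).hom = 𝟙 (𝟙_ C) ▷ X.obj ≫ 𝟙 (𝟙_ C ⊗ X.obj) ≫ (λ_ X.obj).hom
        monoidal
      right_unitality := fun X => by
        change (ρ_ X.obj).hom = X.obj ◁ 𝟙 (𝟙_ C) ≫ 𝟙 (X.obj ⊗ 𝟙_ C) ≫ (ρ_ X.obj).hom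
        monoidal }

end Herm

lemma hermObj_hom_ext {k : Level} {X : DagCat.{v, max u v} k} {Y : AICat.{v, u} k}
    {F G : X ⟶ hermObj Y} (hobj : ∀ x, F.functor.obj x = G.functor.obj x)
    (hmap : ∀ {x y : X.carrier} (f : x ⟶ y), (F.functor.map f).hom ≍ (G.functor.map f).hom)
    (hε : (Functor.LaxMonoidal.ε F.functor).hom ≍ (Functor.LaxMonoidal.ε G.functor).hom)
    (hμ : ∀ x y, (Functor.LaxMonoidal.μ F.functor x y).hom ≍
      (Functor.LaxMonoidal.μ G.functor x y).hom) : F = G :=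
  DagCat.hom_ext_heq hobj (fun f => Herm.hom_heq (hobj _) (hobj _) (hmap f))
    (Herm.hom_heq rfl (hobj _) hε)
    (fun x y => Herm.hom_heq (congrArg₂ Herm.tensor (hobj x) (hobj y)) (hobj _) (hμ x y))

section HermLift

variable {k : Level} {D : DagCat.{v, max u v} k} {C : AICat.{v, max u v} k}
  (F : canonicalObj D ⟶ C)

/-- The object `F x` with the Hermitian pairing `φ_x`, for an anti-involutive functor `(F, φ)` out
of a dagger category. -/
def hermLiftObj (x : D.carrier) : Herm C.carrier where
  obj := F.functor.obj x
  pairing := F.phiApp x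
  hermitian := (F.phi_eta x).symm.trans <|
    (congrArg (· ≫ _) (F.functor.map_id x)).trans (Category.id_comp _)

/-- The functor underlying the lift of an anti-involutive functor `F : D ⥤ C` out of a dagger
category to `Herm C`. -/
def hermLiftFunctor : D.carrier ⥤ Herm C.carrier where
  obj := hermLiftObj F
  map f := ⟨F.functor.map f⟩
  map_id x := Herm.hom_ext (F.functor.map_id x)
  map_comp f g := Herm.hom_ext (F.functor.map_comp f g)

instance hermLiftMonoidal : (hermLiftFunctor F).Monoidal :=
  Functor.CoreMonoidal.toMonoidal
    { εIso := Herm.isoMk (Functor.Monoidal.εIso F.functor)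
      μIso := fun x y => Herm.isoMk (Functor.Monoidal.μIso F.functor x y)
      μIso_hom_natural_left := fun f z =>
        Herm.hom_ext (Functor.LaxMonoidal.μ_natural_left F.functor f z)
      μIso_hom_natural_right := fun z f =>
        Herm.hom_ext (Functor.LaxMonoidal.μ_natural_right F.functor z f)
      associativity := fun x y z =>
        Herm.hom_ext (Functor.LaxMonoidal.associativity F.functor x y z)
      left_unitality := fun x => Herm.hom_ext (Functor.LaxMonoidal.left_unitality F.functor x)
      right_unitality := fun x => Herm.hom_ext (Functor.LaxMonoidal.right_unitality F.functor x) }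

lemma hermLiftFunctor_map_dag {x y : D.carrier} (f : x ⟶ y) :
    (hermLiftFunctor F).map (dag f) = dag ((hermLiftFunctor F).map f) :=
  Herm.hom_ext <| ((Iso.eq_comp_inv (F.phiApp x)).2 (F.phi_natural f)).trans <|
    (Category.assoc _ _ _).trans (Herm.dag_hom ((hermLiftFunctor F).map f)).symm

lemma hermLiftFunctor_unitary_unit :
    IsUnitary (Functor.LaxMonoidal.ε (hermLiftFunctor F)) :=
  (Herm.isUnitary_iff_of_iso (Functor.Monoidal.εIso (hermLiftFunctor F))).2 <|
    (congrArg (Functor.LaxMonoidal.ε F.functor ≫ ·)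
      ((congrArg (· ≫ _) (F.functor.map_id _)).trans (Category.id_comp _)).symm).trans F.phi_unit

lemma hermLiftFunctor_unitary_tensor (x y : D.carrier) :
    IsUnitary (Functor.LaxMonoidal.μ (hermLiftFunctor F) x y) :=
  (Herm.isUnitary_iff_of_iso (Functor.Monoidal.μIso (hermLiftFunctor F) x y)).2 <|
    (congrArg (Functor.LaxMonoidal.μ F.functor x y ≫ ·)
      ((congrArg (· ≫ _) (F.functor.map_id _)).trans (Category.id_comp _)).symm).trans
        (F.phi_tensor x y).symm

/-- The 1-morphism of dagger categories `D ⟶ Herm C` obtained from an anti-involutive functor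
`(F, φ) : D ⟶ C` by equipping `F x` with the pairing `φ_x`. -/
def hermLift : D ⟶ hermObj C :=
  { functor := hermLiftFunctor F
    monoidal := hermLiftMonoidal F
    map_dag := hermLiftFunctor_map_dag F
    unitary_unit := hermLiftFunctor_unitary_unit F
    unitary_tensor := hermLiftFunctor_unitary_tensor F
    isBraided := fun hk x y => Herm.hom_ext (F.isBraided hk x y) }

end HermLift

section HermCounit

variable {k : Level}

/-- The forgetful functor `Herm C ⥤ C` as an anti-involutive functor: the comparison isomorphism on
`(c, h)` is `h`. It is the counit of the adjunction between the canonical 2-functor and the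
Hermitian completion. -/
def hermCounit (C : AICat.{v, max u v} k) : canonicalObj (hermObj C) ⟶ C :=
  { functor := Herm.forget C.carrier
    monoidal := Herm.forgetMonoidal (C := C.carrier)
    phi := NatIso.ofComponents (fun x => Herm.pairing (C := C.carrier) (unop x))
      (fun f => Herm.dag_hom_comp_pairing (C := C.carrier) f.unop)
    phi_eta := fun x =>
      (Category.id_comp (Herm.pairing (C := C.carrier) x).hom).trans (Herm.pairing_dMap x).symm
    phi_unit := by
      change 𝟙 _ ≫ 𝟙 (𝟙_ C.carrier) ≫ (uIso C.carrier).hom ≫ dMap (𝟙 (𝟙_ C.carrier)) = _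
      simp only [dMap_id, Category.comp_id, Category.id_comp]
    phi_tensor := fun x y => by
      change ((Herm.pairing (C := C.carrier) x).hom ⊗ₘ
        (Herm.pairing (C := C.carrier) y).hom) ≫ (chi x.obj y.obj).hom =
        𝟙 (x.obj ⊗ y.obj) ≫ 𝟙 _ ≫ (((Herm.pairing (C := C.carrier) x).hom ⊗ₘ
          (Herm.pairing (C := C.carrier) y).hom) ≫ (chi x.obj y.obj).hom) ≫
          dMap (𝟙 (x.obj ⊗ y.obj))
      simp only [dMap_id, Category.comp_id, Category.id_comp]
    isBraided := fun hk x y =>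
      ((Category.id_comp (C.braiding.beta hk x.obj y.obj).hom).trans
        (Category.comp_id (C.braiding.beta hk x.obj y.obj).hom).symm) }

lemma hermCounit_naturality {C C' : AICat.{v, max u v} k} (F : C ⟶ C') :
    canonicalMap (hermMap F) ≫ hermCounit C' = hermCounit C ≫ F :=
  AICat.Hom.mk_eq
    ((Category.id_comp (Functor.LaxMonoidal.ε F.functor)).trans
      ((congrArg (_ ≫ ·) (F.functor.map_id _)).trans (Category.comp_id _)).symm)
    (funext fun x => funext fun y =>
      (Category.id_comp (Functor.LaxMonoidal.μ F.functor x.obj y.obj)).trans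
      ((congrArg (_ ≫ ·) (F.functor.map_id _)).trans (Category.comp_id _)).symm)
    (fun x => Category.id_comp (F.functor.map x.unop.pairing.hom ≫ (F.phiApp x.unop.obj).hom))

lemma hermLift_hermCounit {D : DagCat.{v, max u v} k} {C : AICat.{v, max u v} k}
    (F : canonicalObj D ⟶ C) : canonicalMap (hermLift F) ≫ hermCounit C = F :=
  AICat.Hom.mk_eq
    (Category.id_comp (Functor.LaxMonoidal.ε F.functor))
    (funext fun x => funext fun y => Category.id_comp (Functor.LaxMonoidal.μ F.functor x y))
    (fun x => Category.id_comp (F.phiApp x.unop).hom)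

lemma hermLift_canonicalMap_comp_hermCounit {D : DagCat.{v, max u v} k}
    {C : AICat.{v, max u v} k} (F : D ⟶ hermObj C) :
    hermLift (canonicalMap F ≫ hermCounit C) = F :=
  hermObj_hom_ext
    (fun x => Herm.ext_pairing (Category.id_comp (F.functor.obj x).pairing.hom))
    (fun _ => HEq.rfl)
    (heq_of_eq (Category.id_comp (Functor.LaxMonoidal.ε F.functor).hom))
    (fun x y => heq_of_eq (Category.id_comp (Functor.LaxMonoidal.μ F.functor x y).hom))

lemma AICat.hom₂_heq {X Y : AICat.{v, u} k} {F G F' G' : X ⟶ Y} (hF : F = F') (hG : G = G')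
    {σ : F ⟶ G} {τ : F' ⟶ G'}
    (h : ∀ x, σ.toNatTrans.app x ≍ τ.toNatTrans.app x) : σ ≍ τ := by
  subst hF hG
  exact heq_of_eq (AICat.hom₂_ext fun x => eq_of_heq (h x))

/-- The anti-involutive functors `Herm C ⥤ C` are couniversal arrows from the canonical
2-functor. -/
def hermCouniversal (k : Level) :
    CouniversalArrows (canonical.{v, max u v} k) (hermData.{v, max u v} k) where
  arrow := hermCounit
  naturality := hermCounit_naturality
  naturality₂ := fun {_ _ F G} _ =>
    AICat.hom₂_heq (hermCounit_naturality F) (hermCounit_naturality G) fun _ => HEq.rfl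
  lift := hermLift
  lift_arrow := hermLift_hermCounit
  lift_map_arrow := hermLift_canonicalMap_comp_hermCounit
  hom₂_ext := fun h => DagCat.hom₂_ext fun x => Herm.hom_ext <|
    congrArg (fun σ => (AICat.Hom₂.toNatTrans σ).app x) h

end HermCounit

/-! ### Full dagger subcategories and positive pairings -/

namespace DagCat

variable {k : Level}

/-- The corestriction of a 1-morphism to a full dagger subcategory that contains its image. -/
def corestrict {D E : DagCat.{v, u} k} (F : D ⟶ E) (Q : ObjectProperty E.carrier)
    [Q.IsMonoidal] (h : ∀ x, Q (F.functor.obj x)) : D ⟶ E.full Q :=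
  { functor := Q.lift F.functor h
    monoidal := Functor.CoreMonoidal.toMonoidal
      { εIso := Q.isoMk (Functor.Monoidal.εIso F.functor)
        μIso := fun x y => Q.isoMk (Functor.Monoidal.μIso F.functor x y)
        μIso_hom_natural_left := fun f z => ObjectProperty.hom_ext _
          (Functor.LaxMonoidal.μ_natural_left F.functor f z)
        μIso_hom_natural_right := fun z f => ObjectProperty.hom_ext _
          (Functor.LaxMonoidal.μ_natural_right F.functor z f)
        associativity := fun x y z => ObjectProperty.hom_ext _
          (Functor.LaxMonoidal.associativity F.functor x y z)
        left_unitality := fun x => ObjectProperty.hom_ext _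
          (Functor.LaxMonoidal.left_unitality F.functor x)
        right_unitality := fun x => ObjectProperty.hom_ext _
          (Functor.LaxMonoidal.right_unitality F.functor x) }
    map_dag := fun f => ObjectProperty.hom_ext _ (F.map_dag f)
    unitary_unit := full_isUnitary Q F.unitary_unit
    unitary_tensor := fun x y => full_isUnitary Q (F.unitary_tensor x y)
    isBraided := fun hk x y => ObjectProperty.hom_ext _ (F.isBraided hk x y) }

/-- The inclusion of a full dagger subcategory. -/
def inclusion (E : DagCat.{v, u} k) (Q : ObjectProperty E.carrier) [Q.IsMonoidal] :
    E.full Q ⟶ E :=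
  { functor := Q.ι
    monoidal := (inferInstance : Functor.Monoidal (C := Q.FullSubcategory) (D := E.carrier) Q.ι)
    map_dag := fun _ => rfl
    unitary_unit := IsUnitary.id (C := E.carrier) _
    unitary_tensor := fun _ _ => IsUnitary.id (C := E.carrier) _
    isBraided := fun hk x y =>
      (Category.id_comp (E.braiding.beta hk x.obj y.obj).hom).trans
        (Category.comp_id (E.braiding.beta hk x.obj y.obj).hom).symm }

lemma corestrict_inclusion {D E : DagCat.{v, u} k} (F : D ⟶ E) (Q : ObjectProperty E.carrier)
    [Q.IsMonoidal] (h : ∀ x, Q (F.functor.obj x)) :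
    corestrict F Q h ≫ inclusion E Q = F :=
  DagCat.Hom.mk_eq (Category.id_comp (Functor.LaxMonoidal.ε F.functor))
    (funext fun x => funext fun y => Category.id_comp (Functor.LaxMonoidal.μ F.functor x y))

lemma corestrict_eq {D E : DagCat.{v, u} k} {Q : ObjectProperty E.carrier} [Q.IsMonoidal]
    {F : D ⟶ E.full Q} {G : D ⟶ E} (hFG : G = F ≫ inclusion E Q)
    (h : ∀ x, Q (G.functor.obj x)) : corestrict G Q h = F := by
  subst hFG
  exact DagCat.Hom.mk_eq
    (ObjectProperty.hom_ext _ (Category.id_comp (Functor.LaxMonoidal.ε F.functor).hom))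
    (funext fun x => funext fun y => ObjectProperty.hom_ext _
      (Category.id_comp (Functor.LaxMonoidal.μ F.functor x y).hom))

lemma restrict_inclusion {D E : DagCat.{v, u} k} (F : D ⟶ E) (P : ObjectProperty D.carrier)
    [P.IsMonoidal] (Q : ObjectProperty E.carrier) [Q.IsMonoidal]
    (h : ∀ x, P x → Q (F.functor.obj x)) :
    restrict F P Q h ≫ inclusion E Q = inclusion D P ≫ F :=
  DagCat.Hom.mk_eq
    ((Category.id_comp (Functor.LaxMonoidal.ε F.functor)).trans
      ((congrArg (_ ≫ ·) (F.functor.map_id _)).trans (Category.comp_id _)).symm)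
    (funext fun x => funext fun y =>
      (Category.id_comp (Functor.LaxMonoidal.μ F.functor x.obj y.obj)).trans
      ((congrArg (_ ≫ ·) (F.functor.map_id _)).trans (Category.comp_id _)).symm)

end DagCat

section HermPos

variable {k : Level}

/-- The full dagger subcategory `C_P` of `Herm C` on the positive pairings. -/
abbrev hermPosObj (X : AIPosCat.{v, u} k) : DagCat.{v, max u v} k :=
  (hermObj X.toAICat).full X.positive

lemma Herm.eq_comp_dag_iff {C : Type u} [Category.{v} C] [AntiInvolution C] {X Y : Herm C}
    (p : X ⟶ X) (g : X ⟶ Y) :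
    p = g ≫ dag g ↔ p.hom ≫ X.pairing.hom = g.hom ≫ Y.pairing.hom ≫ dMap g.hom := by
  rw [← dag_hom_comp_pairing, ← Category.assoc, cancel_mono, ← comp_hom]
  exact ⟨congrArg Hom.hom, hom_ext⟩

/-- The anti-involutive functor `C_P ⥤ C` that forgets the pairing. -/
def hermPosForget (X : AIPosCat.{v, max u v} k) : canonicalObj (hermPosObj X) ⟶ X.toAICat :=
  canonicalMap (DagCat.inclusion (hermObj X.toAICat) X.positive) ≫ hermCounit X.toAICat

lemma hermPosObj_eq_comp_dag_iff {X : AIPosCat.{v, u} k} {c z : (hermPosObj X).carrier}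
    (p : c ⟶ c) (g : c ⟶ z) :
    p = g ≫ dag g ↔
      p.hom.hom ≫ c.obj.pairing.hom = g.hom.hom ≫ z.obj.pairing.hom ≫ dMap g.hom.hom :=
  Iff.trans ⟨congrArg InducedCategory.Hom.hom, ObjectProperty.hom_ext _⟩
    (Herm.eq_comp_dag_iff p.hom g.hom)

/-- The pairing of `x` is an automorphism `p` of some `(c, h)`, and its image in `C` is `h ∘ p`. If
that is positive, the identity of `c` as a map `(c, h) ⟶ (c, h ∘ p)` exhibits `p` as `g† ∘ g`. -/
lemma hermPosForget_pos_iff (X : AIPosCat.{v, max u v} k)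
    (x : Herm (canonicalObj (hermPosObj X)).carrier) :
    X.positivity.pos (hermFunctorObj (hermPosForget X) x) ↔
      (canonicalPositivity (hermPosObj X)).pos x := by
  let c : (hermPosObj X).carrier := x.obj
  let p : c ≅ c := x.pairing
  have image_pairing : (hermFunctorObj (hermPosForget X) x).pairing.hom =
      p.hom.hom.hom ≫ c.obj.pairing.hom :=
    congrArg (p.hom.hom.hom ≫ ·) (Category.id_comp c.obj.pairing.hom)
  constructor
  · intro hx
    refine ⟨⟨hermFunctorObj (hermPosForget X) x, hx⟩,
      X.positive.isoMk (Herm.isoMk (Iso.refl c.obj.obj)),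
      (hermPosObj_eq_comp_dag_iff p.hom _).2 (image_pairing.symm.trans ?_)⟩
    exact ((Category.id_comp _).trans <|
      (congrArg (_ ≫ ·) (dMap_id c.obj.obj)).trans (Category.comp_id _)).symm
  · rintro ⟨Z, g, hg⟩
    let e : c.obj.obj ≅ Z.obj.obj := (Herm.forget _).mapIso (X.positive.ι.mapIso g)
    have image_eq : hermFunctorObj (hermPosForget X) x = Z.obj.transfer e :=
      Herm.ext_pairing (image_pairing.trans ((hermPosObj_eq_comp_dag_iff p.hom g.hom).1 hg))
    exact image_eq ▸ X.positivity.transfer_mem Z.obj Z.property e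

/-- The anti-involutive functor `C_P ⥤ C` as a 1-morphism `(C_P, Pos(C_P)) ⟶ (C, P)`: the counit of
the adjunction between `D ↦ (D, Pos(D))` and `(C, P) ↦ C_P`. -/
def hermPosCounit (X : AIPosCat.{v, max u v} k) : (canonicalPos k).obj (hermPosObj X) ⟶ X :=
  ⟨hermPosForget X, fun x => (hermPosForget_pos_iff X x).2⟩

lemma canonicalMap_inclusion_comp_hermCounit_naturality {X Y : AIPosCat.{v, max u v} k}
    (F : X ⟶ Y) :
    canonicalMap (DagCat.inclusion (hermObj X.toAICat) X.positive ≫ hermMap F.hom) ≫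
      hermCounit Y.toAICat = hermPosForget X ≫ F.hom := by
  rw [hermPosForget, canonical_map_comp, AICat.assoc', AICat.assoc', hermCounit_naturality]

lemma hermPosCounit_naturality {X Y : AIPosCat.{v, max u v} k} (F : X ⟶ Y) :
    (canonicalPos k).map ((hermPosData k).map F) ≫ hermPosCounit Y = hermPosCounit X ≫ F :=
  AIPosCat.hom_ext' <| (AICat.assoc' _ _ _).symm.trans <|
    (congrArg (· ≫ hermCounit Y.toAICat) (canonical_map_comp _ _)).symm.trans <|
    (congrArg (fun K => canonicalMap K ≫ hermCounit Y.toAICat) <|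
      DagCat.restrict_inclusion (hermMap F.hom) X.positive Y.positive F.preserves).trans <|
    canonicalMap_inclusion_comp_hermCounit_naturality F

lemma hermLiftObj_positive {D : DagCat.{v, max u v} k} {X : AIPosCat.{v, max u v} k}
    (F : (canonicalPos k).obj D ⟶ X) (x : D.carrier) :
    X.positivity.pos (hermLiftObj (C := X.toAICat) F.hom x) := by
  let identity : Herm (canonicalObj D).carrier :=
    ⟨x, Iso.refl (C := D.carrier) x, (Category.id_comp _).trans (dag_id (C := D.carrier) x)⟩
  have image_eq : hermFunctorObj F.hom identity = hermLiftObj (C := X.toAICat) F.hom x :=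
    Herm.ext_pairing <|
      (congrArg (· ≫ _) (F.hom.functor.map_id x)).trans (Category.id_comp _)
  exact image_eq ▸ F.preserves identity (IsIsoPositive.id (C := D.carrier) x)

/-- The lift of `F : (D, Pos(D)) ⟶ (C, P)` to a 1-morphism `D ⟶ C_P` of dagger categories. -/
def hermPosLift {D : DagCat.{v, max u v} k} {X : AIPosCat.{v, max u v} k}
    (F : (canonicalPos k).obj D ⟶ X) : D ⟶ hermPosObj X :=
  DagCat.corestrict (hermLift (C := X.toAICat) F.hom) X.positive (hermLiftObj_positive F)

lemma hermPosLift_hermPosCounit {D : DagCat.{v, max u v} k} {X : AIPosCat.{v, max u v} k}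
    (F : (canonicalPos k).obj D ⟶ X) :
    (canonicalPos k).map (hermPosLift F) ≫ hermPosCounit X = F :=
  AIPosCat.hom_ext' <| (AICat.assoc' _ _ _).symm.trans <|
    (congrArg (· ≫ hermCounit X.toAICat) (canonical_map_comp _ _)).symm.trans <|
    (congrArg (fun K => canonicalMap K ≫ hermCounit X.toAICat) <|
      DagCat.corestrict_inclusion (hermLift (C := X.toAICat) F.hom) X.positive
        (hermLiftObj_positive F)).trans <|
    hermLift_hermCounit _

lemma hermPosLift_map_comp_hermPosCounit {D : DagCat.{v, max u v} k}
    {X : AIPosCat.{v, max u v} k} (F : D ⟶ hermPosObj X) :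
    hermPosLift ((canonicalPos k).map F ≫ hermPosCounit X) = F :=
  have forget_eq : canonicalMap F ≫ hermPosForget X =
      canonicalMap (F ≫ DagCat.inclusion (hermObj X.toAICat) X.positive) ≫
        hermCounit X.toAICat := by
    rw [hermPosForget, canonical_map_comp, AICat.assoc']
  DagCat.corestrict_eq
    ((congrArg hermLift forget_eq).trans (hermLift_canonicalMap_comp_hermCounit _)) _

lemma AIPosCat.hom₂_heq {X Y : AIPosCat.{v, u} k} {F G F' G' : X ⟶ Y} (hF : F = F') (hG : G = G')
    {σ : F ⟶ G} {τ : F' ⟶ G'}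
    (h : ∀ x, σ.hom.toNatTrans.app x ≍ τ.hom.toNatTrans.app x) : σ ≍ τ := by
  subst hF hG
  exact heq_of_eq <| AIPosCat.hom₂_ext <| AICat.hom₂_ext fun x => eq_of_heq (h x)

/-- The anti-involutive functors `C_P ⥤ C` are couniversal arrows from `D ↦ (D, Pos(D))`. -/
def hermPosCouniversal (k : Level) :
    CouniversalArrows (canonicalPos.{v, max u v} k) (hermPosData.{v, max u v} k) where
  arrow := hermPosCounit
  naturality := hermPosCounit_naturality
  naturality₂ := fun {_ _ F G} _ => AIPosCat.hom₂_heq (hermPosCounit_naturality F)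
    (hermPosCounit_naturality G) fun _ => HEq.rfl
  lift := hermPosLift
  lift_arrow := hermPosLift_hermPosCounit
  lift_map_arrow := hermPosLift_map_comp_hermPosCounit
  hom₂_ext := fun h => DagCat.hom₂_ext fun x => ObjectProperty.hom_ext _ <| Herm.hom_ext <|
    congrArg (fun σ => (AIPosCat.Hom₂.hom σ).toNatTrans.app x) h

end HermPos

/-! ### Equivalences -/

lemma isEquivalence_of_iso {B : Type u₁} [Bicategory.{v, v₁} B] {X Y : B} {f : X ⟶ Y} {g : Y ⟶ X}
    (e : 𝟙 X ≅ f ≫ g) (e' : g ≫ f ≅ 𝟙 Y) : IsEquivalence f :=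
  ⟨Bicategory.Equivalence.mkOfAdjointifyCounit e e', rfl⟩

namespace BraidingData

variable {k : Level}

lemma isPreservedBy_of_iso {C : Type u₁} [Category.{v₁} C] [MonoidalCategory C]
    {D : Type u₂} [Category.{v₂} D] [MonoidalCategory D] {B : BraidingData k C}
    {B' : BraidingData k D} {F G : C ⥤ D} [F.Monoidal] [G.Monoidal] (e : F ≅ G)
    [he : NatTrans.IsMonoidal e.hom] (h : B.IsPreservedBy B' F) : B.IsPreservedBy B' G := by
  intro hk X Y
  have beta_natural : (e.hom.app X ⊗ₘ e.hom.app Y) ≫ (B'.beta hk (G.obj X) (G.obj Y)).hom =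
      (B'.beta hk (F.obj X) (F.obj Y)).hom ≫ (e.hom.app Y ⊗ₘ e.hom.app X) :=
    letI := B'.braiding hk
    BraidedCategory.braiding_naturality (e.hom.app X) (e.hom.app Y)
  rw [← cancel_epi (e.hom.app X ⊗ₘ e.hom.app Y), ← reassoc_of% (he.tensor X Y),
    reassoc_of% beta_natural, ← he.tensor Y X, ← reassoc_of% h hk X Y, e.hom.naturality]

lemma isPreservedBy_of_comp_faithful {C : Type u₁} [Category.{v₁} C] [MonoidalCategory C]
    {D : Type u₂} [Category.{v₂} D] [MonoidalCategory D] {E : Type u} [Category.{v} E]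
    [MonoidalCategory E]
    {B : BraidingData k C} {B' : BraidingData k D} {B'' : BraidingData k E} {F : C ⥤ D} {G : D ⥤ E}
    [F.Monoidal] [G.Monoidal] [G.Faithful] (hG : B'.IsPreservedBy B'' G)
    (hFG : B.IsPreservedBy B'' (F ⋙ G)) : B.IsPreservedBy B' F := by
  intro hk X Y
  apply G.map_injective
  have h := hFG hk X Y
  simp only [Functor.LaxMonoidal.comp_μ, Functor.comp_map, Category.assoc, Functor.comp_obj] at h
  rw [← cancel_epi (Functor.LaxMonoidal.μ G (F.obj X) (F.obj Y)), G.map_comp, h, G.map_comp,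
    reassoc_of% hG hk (F.obj X) (F.obj Y)]

lemma isPreservedBy_inverse {C : Type u₁} [Category.{v₁} C] [MonoidalCategory C] {D : Type u₂}
    [Category.{v₂} D] [MonoidalCategory D] {B : BraidingData k C} {B' : BraidingData k D}
    (e : C ≌ D) [e.functor.Monoidal] [e.inverse.Monoidal] [e.IsMonoidal]
    (h : B.IsPreservedBy B' e.functor) : B'.IsPreservedBy B e.inverse :=
  have : NatTrans.IsMonoidal e.counitIso.hom :=
    inferInstanceAs (NatTrans.IsMonoidal e.toAdjunction.counit)
  have : NatTrans.IsMonoidal e.counitIso.symm.hom :=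
    inferInstanceAs (NatTrans.IsMonoidal e.counitIso.inv)
  isPreservedBy_of_comp_faithful h (isPreservedBy_of_iso e.counitIso.symm B'.isPreservedBy_id)

end BraidingData

lemma IsUnitary.dag {C : Type u} [Category.{v} C] [DaggerCategory C] {X Y : C} {f : X ⟶ Y}
    (h : IsUnitary f) : IsUnitary (dag f) := by
  rw [IsUnitary, dag_dag]
  exact ⟨h.2, h.1⟩

lemma IsUnitary.symm {C : Type u} [Category.{v} C] [DaggerCategory C] {X Y : C} {e : X ≅ Y}
    (h : IsUnitary e.hom) : IsUnitary e.inv :=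
  (isUnitary_iff_dag_eq_inv e).1 h ▸ h.dag

lemma IsUnitary.of_comp {C : Type u} [Category.{v} C] [DaggerCategory C] {X Y Z : C} {f : X ⟶ Y}
    {g : Y ⟶ Z} (hfg : IsUnitary (f ≫ g)) (hg : IsUnitary g) : IsUnitary f := by
  simpa only [Category.assoc, hg.1, Category.comp_id] using hfg.comp hg.dag

lemma IsUnitary.tensorHom {C : Type u} [Category.{v} C] [DaggerCategory C] [MonoidalCategory C]
    [MonoidalDagger C] {X Y X' Y' : C} {f : X ⟶ Y} {g : X' ⟶ Y'} (hf : IsUnitary f)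
    (hg : IsUnitary g) : IsUnitary (f ⊗ₘ g) := by
  rw [IsUnitary, MonoidalDagger.dag_tensorHom, tensorHom_comp_tensorHom, tensorHom_comp_tensorHom,
    hf.1, hf.2, hg.1, hg.2, id_tensorHom_id, id_tensorHom_id]
  exact ⟨rfl, rfl⟩

/-- The adjoint equivalence given by a fully faithful functor `F` and a choice, for every `y`, of an
object `obj y` with an isomorphism `F (obj y) ≅ y`, which becomes the counit. -/
noncomputable def equivalenceOfObjIso {C : Type u₁} [Category.{v₁} C] {D : Type u₂}
    [Category.{v₂} D] (F : C ⥤ D) [F.Full] [F.Faithful]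
    (obj : D → C) (iso : ∀ y, F.obj (obj y) ≅ y) : C ≌ D where
  functor := F
  inverse :=
    { obj := obj
      map := fun {y z} f => F.preimage ((iso y).hom ≫ f ≫ (iso z).inv)
      map_id := fun y => F.map_injective (by simp)
      map_comp := fun f g => F.map_injective (by simp) }
  unitIso := NatIso.ofComponents (fun x => F.preimageIso (iso (F.obj x)).symm)
    (fun f => F.map_injective (by simp))
  counitIso := NatIso.ofComponents iso (by simp)
  functor_unitIso_comp x := by simp

lemma inverseMonoidal_isMonoidal {C : Type u₁} [Category.{v₁} C] [MonoidalCategory C]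
    {D : Type u₂} [Category.{v₂} D] [MonoidalCategory D] (e : C ≌ D) [e.functor.Monoidal] :
    letI := e.inverseMonoidal
    e.IsMonoidal :=
  letI := e.inverseMonoidal
  ⟨rfl, fun _ _ => rfl⟩

section DaggerInverse

variable {C : Type u₁} [Category.{v₁} C] [DaggerCategory C] {D : Type u₂} [Category.{v₂} D]
  [DaggerCategory D]

lemma isUnitary_map_iff {F : C ⥤ D} [F.Faithful]
    (map_dag : ∀ {x y : C} (f : x ⟶ y), F.map (dag f) = dag (F.map f)) {x y : C} {f : x ⟶ y} :
    IsUnitary (F.map f) ↔ IsUnitary f := by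
  simp only [IsUnitary, ← map_dag, ← F.map_comp, ← F.map_id, F.map_injective.eq_iff]

variable {e : C ≌ D}

lemma inverse_map_dag
    (map_dag : ∀ {x y : C} (f : x ⟶ y), e.functor.map (dag f) = dag (e.functor.map f))
    (unitary : ∀ y, IsUnitary (e.counit.app y)) {y z : D} (f : y ⟶ z) :
    e.inverse.map (dag f) = dag (e.inverse.map f) := by
  have dag_counit (y : D) : dag (e.counit.app y) = e.counitInv.app y :=
    (isUnitary_iff_dag_eq_inv (e.counitIso.app y)).1 (unitary y)
  have dag_counitInv (y : D) : dag (e.counitInv.app y) = e.counit.app y := by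
    rw [← dag_counit, dag_dag]
  apply e.functor.map_injective
  simp only [map_dag, Equivalence.fun_inv_map, dag_comp, dag_counit, dag_counitInv,
    Category.assoc]

lemma isUnitary_unit_app
    (map_dag : ∀ {x y : C} (f : x ⟶ y), e.functor.map (dag f) = dag (e.functor.map f))
    (unitary : ∀ y, IsUnitary (e.counit.app y)) (x : C) :
    IsUnitary (e.unit.app x) := by
  rw [← isUnitary_map_iff map_dag, ← e.counitInv_app_functor]
  exact (unitary _).symm (e := e.counitIso.app _)

variable [MonoidalCategory C] [MonoidalCategory D] [e.functor.Monoidal] [e.inverse.Monoidal]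
  [e.IsMonoidal]

lemma isUnitary_ε_inverse
    (map_dag : ∀ {x y : C} (f : x ⟶ y), e.functor.map (dag f) = dag (e.functor.map f))
    (unitary : ∀ y, IsUnitary (e.counit.app y))
    (unitary_unit : IsUnitary (Functor.LaxMonoidal.ε e.functor)) :
    IsUnitary (Functor.LaxMonoidal.ε e.inverse) := by
  rw [← isUnitary_map_iff map_dag]
  refine IsUnitary.of_comp ?_ (unitary _)
  rw [e.functor_map_ε_inverse_comp_counit_app]
  exact unitary_unit.symm (e := Functor.Monoidal.εIso e.functor)

lemma isUnitary_μ_inverse [MonoidalDagger D]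
    (map_dag : ∀ {x y : C} (f : x ⟶ y), e.functor.map (dag f) = dag (e.functor.map f))
    (unitary : ∀ y, IsUnitary (e.counit.app y))
    (unitary_tensor : ∀ x y, IsUnitary (Functor.LaxMonoidal.μ e.functor x y)) (x y : D) :
    IsUnitary (Functor.LaxMonoidal.μ e.inverse x y) := by
  rw [← isUnitary_map_iff map_dag]
  refine IsUnitary.of_comp ?_ (unitary _)
  rw [e.functor_map_μ_inverse_comp_counit_app_tensor]
  exact ((unitary_tensor _ _).symm (e := Functor.Monoidal.μIso e.functor _ _)).comp
    ((unitary x).tensorHom (unitary y))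

end DaggerInverse

namespace DagCat

variable {k : Level} {X Y : DagCat.{v, u} k}

section

variable (F : X ⟶ Y) [F.functor.Full] [F.functor.Faithful] (obj : Y.carrier → X.carrier)
  (iso : ∀ y, F.functor.obj (obj y) ≅ y) (unitary : ∀ y, IsUnitary (iso y).hom)

noncomputable instance : (equivalenceOfObjIso F.functor obj iso).functor.Monoidal := F.monoidal

noncomputable instance : (equivalenceOfObjIso F.functor obj iso).inverse.Monoidal :=
  (equivalenceOfObjIso F.functor obj iso).inverseMonoidal

instance : (equivalenceOfObjIso F.functor obj iso).IsMonoidal :=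
  inverseMonoidal_isMonoidal _

/-- The inverse of a fully faithful 1-morphism `F` of dagger categories, given by a choice, for
every `y`, of an object `obj y` with a unitary isomorphism `F (obj y) ≅ y`. -/
noncomputable def inverse : Y ⟶ X :=
  let e := equivalenceOfObjIso F.functor obj iso
  { functor := e.inverse
    map_dag := inverse_map_dag (e := e) F.map_dag unitary
    unitary_unit := isUnitary_ε_inverse (e := e) F.map_dag unitary F.unitary_unit
    unitary_tensor := isUnitary_μ_inverse (e := e) F.map_dag unitary F.unitary_tensor
    isBraided := BraidingData.isPreservedBy_inverse e F.isBraided }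

end

lemma isEquivalence_of_unitary (F : X ⟶ Y) [F.functor.Full] [F.functor.Faithful]
    (unitary_essSurj : ∀ y, ∃ x, ∃ e : F.functor.obj x ≅ y, IsUnitary e.hom) :
    IsEquivalence F := by
  choose obj iso unitary using unitary_essSurj
  let e := equivalenceOfObjIso F.functor obj iso
  exact isEquivalence_of_iso (g := inverse F obj iso unitary)
    (isoMk _ _ e.unitIso (inferInstanceAs (NatTrans.IsMonoidal e.toAdjunction.unit))
      fun x => (isUnitary_unit_app F.map_dag unitary x).1)
    (isoMk _ _ e.counitIso (inferInstanceAs (NatTrans.IsMonoidal e.toAdjunction.counit))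
      fun y => (unitary y).1)

end DagCat

namespace AICat

variable {k : Level} {X Y Z : AICat.{v, u} k}

section Lift

variable (F : X ⟶ Y) [F.functor.Full] [F.functor.Faithful] (H : Z ⟶ Y)
  (G : Z.carrier ⥤ X.carrier) (c : G ⋙ F.functor ≅ H.functor)

/-- For a functor `G` with `c : F ∘ G ≅ H`, where `F` and `H` are anti-involutive and `F` is fully
faithful, the comparison isomorphism `G (d z) ≅ d (G z)` that `F` and `c` transport from `H`. -/
noncomputable def liftPhiApp (z : Z.carrier) : G.obj (dObj z) ≅ dObj (G.obj z) :=
  F.functor.preimageIso <| c.app (dObj z) ≪≫ H.phiApp z ≪≫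
    AntiInvolution.d.mapIso (c.app z).op ≪≫ (F.phiApp (G.obj z)).symm

lemma map_liftPhiApp_comp_phiApp (z : Z.carrier) :
    F.functor.map (liftPhiApp F H G c z).hom ≫ (F.phiApp (G.obj z)).hom =
      c.hom.app (dObj z) ≫ (H.phiApp z).hom ≫ dMap (c.hom.app z) := by
  simp [liftPhiApp, dMap]

lemma liftPhiApp_natural {x y : Z.carrier} (f : x ⟶ y) :
    G.map (dMap f) ≫ (liftPhiApp F H G c x).hom =
      (liftPhiApp F H G c y).hom ≫ dMap (G.map f) := by
  apply F.functor.map_injective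
  rw [← cancel_mono (F.phiApp (G.obj x)).hom, F.functor.map_comp, F.functor.map_comp,
    Category.assoc, Category.assoc, map_liftPhiApp_comp_phiApp, F.phi_natural,
    reassoc_of% map_liftPhiApp_comp_phiApp, ← dMap_comp]
  have c_natural : F.functor.map (G.map f) ≫ c.hom.app y = c.hom.app x ≫ H.functor.map f :=
    c.hom.naturality f
  have c_natural' : F.functor.map (G.map (dMap f)) ≫ c.hom.app (dObj x) =
      c.hom.app (dObj y) ≫ H.functor.map (dMap f) :=
    c.hom.naturality (dMap f)
  rw [c_natural, dMap_comp, ← reassoc_of% H.phi_natural f, reassoc_of% c_natural']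

lemma liftPhiApp_eta (z : Z.carrier) :
    G.map (etaApp z) ≫ (liftPhiApp F H G c (dObj z)).hom =
      etaApp (G.obj z) ≫ dMap (liftPhiApp F H G c z).hom := by
  apply F.functor.map_injective
  have c_natural : F.functor.map (G.map (etaApp z)) ≫ c.hom.app (dObj (dObj z)) =
      c.hom.app z ≫ H.functor.map (etaApp z) :=
    c.hom.naturality (etaApp z)
  have F_eta : F.functor.map (etaApp (G.obj z)) ≫ (F.phiApp (dObj (G.obj z))).hom =
      etaApp (F.functor.obj (G.obj z)) ≫ dMap (F.phiApp (G.obj z)).hom := F.phi_eta _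
  have H_eta : H.functor.map (etaApp z) ≫ (H.phiApp (dObj z)).hom =
      etaApp (H.functor.obj z) ≫ dMap (H.phiApp z).hom := H.phi_eta _
  rw [← cancel_mono (F.phiApp (G.obj (dObj z))).hom, F.functor.map_comp, F.functor.map_comp,
    Category.assoc, Category.assoc, map_liftPhiApp_comp_phiApp, F.phi_natural,
    reassoc_of% F_eta, ← dMap_comp, map_liftPhiApp_comp_phiApp, dMap_comp, dMap_comp,
    reassoc_of% c_natural, reassoc_of% H_eta, reassoc_of% eta_natural, Category.assoc]

variable [G.Monoidal] [hc : NatTrans.IsMonoidal c.hom]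

lemma liftPhiApp_unit : Functor.LaxMonoidal.ε G ≫ G.map (uIso Z.carrier).hom ≫
    (liftPhiApp F H G c (𝟙_ _)).hom ≫ dMap (Functor.LaxMonoidal.ε G) = (uIso X.carrier).hom := by
  have F_unit : Functor.LaxMonoidal.ε F.functor ≫ F.functor.map (uIso X.carrier).hom ≫
      (F.phiApp (𝟙_ _)).hom ≫ dMap (Functor.LaxMonoidal.ε F.functor) = (uIso Y.carrier).hom :=
    F.phi_unit
  have H_unit : Functor.LaxMonoidal.ε H.functor ≫ H.functor.map (uIso Z.carrier).hom ≫
      (H.phiApp (𝟙_ _)).hom ≫ dMap (Functor.LaxMonoidal.ε H.functor) = (uIso Y.carrier).hom :=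
    H.phi_unit
  have c_unit : Functor.LaxMonoidal.ε F.functor ≫ F.functor.map (Functor.LaxMonoidal.ε G) ≫
      c.hom.app (𝟙_ _) = Functor.LaxMonoidal.ε H.functor :=
    (Category.assoc _ _ _).symm.trans hc.unit
  have c_natural : F.functor.map (G.map (uIso Z.carrier).hom) ≫ c.hom.app (dObj (𝟙_ _)) =
      c.hom.app (𝟙_ _) ≫ H.functor.map (uIso Z.carrier).hom :=
    c.hom.naturality (uIso Z.carrier).hom
  apply F.functor.map_injective
  rw [← cancel_epi (Functor.LaxMonoidal.ε F.functor),
    ← cancel_mono ((F.phiApp (𝟙_ _)).hom ≫ dMap (Functor.LaxMonoidal.ε F.functor))]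
  simp only [Functor.map_comp, Category.assoc, F_unit]
  rw [reassoc_of% F.phi_natural, reassoc_of% map_liftPhiApp_comp_phiApp, reassoc_of% c_natural,
    ← dMap_comp, ← dMap_comp, reassoc_of% c_unit, Category.assoc, c_unit, H_unit]

lemma liftPhiApp_tensor (x y : Z.carrier) :
    ((liftPhiApp F H G c x).hom ⊗ₘ (liftPhiApp F H G c y).hom) ≫ (chi (G.obj x) (G.obj y)).hom =
      Functor.LaxMonoidal.μ G (dObj x) (dObj y) ≫ G.map (chi x y).hom ≫
        (liftPhiApp F H G c (x ⊗ y)).hom ≫ dMap (Functor.LaxMonoidal.μ G x y) := by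
  have F_tensor : ((F.phiApp (G.obj x)).hom ⊗ₘ (F.phiApp (G.obj y)).hom) ≫
      (chi (F.functor.obj (G.obj x)) (F.functor.obj (G.obj y))).hom =
      Functor.LaxMonoidal.μ F.functor (dObj (G.obj x)) (dObj (G.obj y)) ≫
        F.functor.map (chi (G.obj x) (G.obj y)).hom ≫ (F.phiApp (G.obj x ⊗ G.obj y)).hom ≫
        dMap (Functor.LaxMonoidal.μ F.functor (G.obj x) (G.obj y)) := F.phi_tensor _ _
  have H_tensor : ((H.phiApp x).hom ⊗ₘ (H.phiApp y).hom) ≫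
      (chi (H.functor.obj x) (H.functor.obj y)).hom =
      Functor.LaxMonoidal.μ H.functor (dObj x) (dObj y) ≫ H.functor.map (chi x y).hom ≫
        (H.phiApp (x ⊗ y)).hom ≫ dMap (Functor.LaxMonoidal.μ H.functor x y) := H.phi_tensor _ _
  have c_tensor (x y : Z.carrier) : Functor.LaxMonoidal.μ F.functor (G.obj x) (G.obj y) ≫
      F.functor.map (Functor.LaxMonoidal.μ G x y) ≫ c.hom.app (x ⊗ y) =
      (c.hom.app x ⊗ₘ c.hom.app y) ≫ Functor.LaxMonoidal.μ H.functor x y :=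
    (Category.assoc _ _ _).symm.trans (hc.tensor x y)
  have c_natural : F.functor.map (G.map (chi x y).hom) ≫ c.hom.app (dObj (x ⊗ y)) =
      c.hom.app (dObj x ⊗ dObj y) ≫ H.functor.map (chi x y).hom :=
    c.hom.naturality (chi x y).hom
  apply F.functor.map_injective
  rw [← cancel_epi (Functor.LaxMonoidal.μ F.functor (G.obj (dObj x)) (G.obj (dObj y))),
    ← cancel_mono ((F.phiApp (G.obj x ⊗ G.obj y)).hom ≫
      dMap (Functor.LaxMonoidal.μ F.functor (G.obj x) (G.obj y)))]
  simp only [Functor.map_comp, Category.assoc]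
  rw [← Functor.LaxMonoidal.μ_natural_assoc, ← F_tensor, tensorHom_comp_tensorHom_assoc,
    map_liftPhiApp_comp_phiApp, map_liftPhiApp_comp_phiApp, reassoc_of% F.phi_natural,
    reassoc_of% map_liftPhiApp_comp_phiApp, reassoc_of% c_natural, ← dMap_comp, ← dMap_comp,
    reassoc_of% c_tensor, Category.assoc, c_tensor, dMap_comp, ← reassoc_of% H_tensor,
    ← chi_natural, ← tensorHom_comp_tensorHom_assoc, ← tensorHom_comp_tensorHom_assoc]
  rfl

/-- The 1-morphism with underlying functor `G` that lifts `H` along the fully faithful `F` up to the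
isomorphism `c : F ∘ G ≅ H`. -/
noncomputable def lift : Z ⟶ X where
  functor := G
  phi := NatIso.ofComponents (fun z => liftPhiApp F H G c z.unop)
    fun f => liftPhiApp_natural F H G c f.unop
  phi_eta := liftPhiApp_eta F H G c
  phi_unit := liftPhiApp_unit F H G c
  phi_tensor := liftPhiApp_tensor F H G c
  isBraided := BraidingData.isPreservedBy_of_comp_faithful F.isBraided
    (BraidingData.isPreservedBy_of_iso c.symm
      (he := inferInstanceAs (NatTrans.IsMonoidal c.inv)) H.isBraided)

/-- The isomorphism `c : F ∘ G ≅ H` as an invertible 2-morphism. -/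
noncomputable def liftCompIso : lift F H G c ≫ F ≅ H :=
  isoOfId _ _ c hc (map_liftPhiApp_comp_phiApp F H G c)

end Lift

/-- A monoidal isomorphism `σ` between 1-morphisms into `X` is an invertible 2-morphism if its image
under a faithful 1-morphism `F` is a 2-morphism. -/
def isoOfComp (F : X ⟶ Y) [F.functor.Faithful] {A B : Z ⟶ X} (σ : A.functor ≅ B.functor)
    (monoidal : NatTrans.IsMonoidal σ.hom) (τ : A ≫ F ⟶ B ≫ F)
    (map_σ : ∀ z, F.functor.map (σ.hom.app z) = (Hom₂.toNatTrans τ).app z) : A ≅ B :=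
  isoOfId A B σ monoidal fun z => by
    have τ_antiInvolutive : F.functor.map (A.phiApp z).hom ≫ (F.phiApp (A.functor.obj z)).hom =
        F.functor.map (σ.hom.app (dObj z)) ≫
          (F.functor.map (B.phiApp z).hom ≫ (F.phiApp (B.functor.obj z)).hom) ≫
            dMap (F.functor.map (σ.hom.app z)) := by
      rw [map_σ, map_σ]
      exact τ.antiInvolutive z
    apply F.functor.map_injective
    rw [← cancel_mono (F.phiApp (A.functor.obj z)).hom, τ_antiInvolutive]
    simp only [Functor.map_comp, Category.assoc, F.phi_natural]

lemma isEquivalence_of_essSurj (F : X ⟶ Y) [F.functor.Full] [F.functor.Faithful]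
    [F.functor.EssSurj] : IsEquivalence F := by
  have : F.functor.IsEquivalence := { }
  let e := F.functor.asEquivalence
  let _ : e.functor.Monoidal := F.monoidal
  let _ := e.inverseMonoidal
  have := inverseMonoidal_isMonoidal e
  have monoidal_counit : NatTrans.IsMonoidal e.counitIso.hom :=
    inferInstanceAs (NatTrans.IsMonoidal e.toAdjunction.counit)
  let inverse : Y ⟶ X := lift F (𝟙 Y) e.inverse e.counitIso (hc := monoidal_counit)
  let counit : inverse ≫ F ≅ 𝟙 Y :=
    liftCompIso F (𝟙 Y) e.inverse e.counitIso (hc := monoidal_counit)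
  refine isEquivalence_of_iso (g := inverse) (isoOfComp F (A := 𝟙 X) (B := F ≫ inverse) e.unitIso
    (inferInstanceAs (NatTrans.IsMonoidal e.toAdjunction.unit))
    ((Bicategory.leftUnitor F).hom ≫ (Bicategory.rightUnitor F).inv ≫
      Bicategory.whiskerLeft F counit.inv ≫ (Bicategory.associator F inverse F).inv) fun x => ?_)
    counit
  exact (e.counitInv_app_functor x).symm.trans <| Eq.symm <| (Category.id_comp _).trans <|
    (Category.id_comp _).trans <| Category.comp_id _

end AICat

/-- The component of an invertible 2-morphism of anti-involutive categories, as an isomorphism. -/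
def AICat.isoApp {k : Level} {X Y : AICat.{v, u} k} {F G : X ⟶ Y} (α : F ≅ G) (x : X.carrier) :
    F.functor.obj x ≅ G.functor.obj x where
  hom := (Hom₂.toNatTrans α.hom).app x
  inv := (Hom₂.toNatTrans α.inv).app x
  hom_inv_id := congrArg (fun σ => (Hom₂.toNatTrans σ).app x) α.hom_inv_id
  inv_hom_id := congrArg (fun σ => (Hom₂.toNatTrans σ).app x) α.inv_hom_id

lemma AICat.hermFunctorObj_eq_transfer {k : Level} {X Y : AICat.{v, u} k} {F G : X ⟶ Y} (α : F ≅ G)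
    (x : Herm X.carrier) :
    hermFunctorObj F x = (hermFunctorObj G x).transfer (isoApp α x.obj) :=
  Herm.ext_pairing <| by
    have naturality : F.functor.map x.pairing.hom ≫ (isoApp α (dObj x.obj)).hom =
        (isoApp α x.obj).hom ≫ G.functor.map x.pairing.hom :=
      (Hom₂.toNatTrans α.hom).naturality x.pairing.hom
    have antiInvolutive : (F.phiApp x.obj).hom = (isoApp α (dObj x.obj)).hom ≫
        (G.phiApp x.obj).hom ≫ dMap (isoApp α x.obj).hom :=
      Hom₂.antiInvolutive α.hom x.obj
    change F.functor.map x.pairing.hom ≫ (F.phiApp x.obj).hom = (isoApp α x.obj).hom ≫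
      (G.functor.map x.pairing.hom ≫ (G.phiApp x.obj).hom) ≫ dMap (isoApp α x.obj).hom
    rw [antiInvolutive, reassoc_of% naturality, Category.assoc]

lemma AIPosCat.isEquivalence_of_reflects {k : Level} {X Y : AIPosCat.{v, u} k} (F : X ⟶ Y)
    (hF : IsEquivalence F.hom)
    (reflects : ∀ x, Y.positivity.pos (hermFunctorObj F.hom x) → X.positivity.pos x) :
    IsEquivalence F := by
  obtain ⟨e, he⟩ := hF
  have inverse_preserves (y) (hy : Y.positivity.pos y) :
      X.positivity.pos (hermFunctorObj e.inv y) := by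
    apply reflects
    rw [← he, ← hermFunctorObj_comp, AICat.hermFunctorObj_eq_transfer e.counit]
    exact Y.positivity.transfer_mem _ ((hermFunctorObj_id _ y).symm ▸ hy) _
  let inverse : Y ⟶ X := ⟨e.inv, inverse_preserves⟩
  exact isEquivalence_of_iso (g := inverse)
    (isoMk _ _ (e.unit ≪≫ eqToIso (congrArg (· ≫ e.inv) he)))
    (isoMk _ _ (eqToIso (congrArg (e.inv ≫ ·) he.symm) ≪≫ e.counit))

section HermPosEquivalence

variable {k : Level}

instance (X : AIPosCat.{v, max u v} k) : (hermPosForget X).functor.Full where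
  map_surjective f := ⟨⟨⟨f⟩⟩, rfl⟩

instance (X : AIPosCat.{v, max u v} k) : (hermPosForget X).functor.Faithful where
  map_injective h := ObjectProperty.hom_ext _ (Herm.hom_ext h)

instance (X : AIPosCat.{v, max u v} k) : (hermPosForget X).functor.EssSurj where
  mem_essImage c :=
    let ⟨h, hpos, hc⟩ := X.positivity.exists_pos c
    ⟨⟨h, hpos⟩, ⟨eqToIso hc⟩⟩

lemma isEquivalence_hermPosCounit (X : AIPosCat.{v, max u v} k) :
    IsEquivalence (hermPosCounit X) :=
  AIPosCat.isEquivalence_of_reflects _ (AICat.isEquivalence_of_essSurj (hermPosForget X))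
    fun x => (hermPosForget_pos_iff X x).1

instance (D : DagCat.{v, max u v} k) :
    (hermPosLift (𝟙 ((canonicalPos k).obj D))).functor.Full where
  map_surjective f := ⟨f.hom.hom, rfl⟩

instance (D : DagCat.{v, max u v} k) :
    (hermPosLift (𝟙 ((canonicalPos k).obj D))).functor.Faithful where
  map_injective h := congrArg (fun f => f.hom.hom) h

lemma isEquivalence_hermPosLift_id (D : DagCat.{v, max u v} k) :
    IsEquivalence (hermPosLift (𝟙 ((canonicalPos k).obj D))) := by
  refine DagCat.isEquivalence_of_unitary _ fun y => ?_
  obtain ⟨z, g, pairing_eq⟩ := y.property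
  let U := hermPosLift (𝟙 ((canonicalPos k).obj D))
  let e : y.obj ≅ (U.functor.obj z).obj := Herm.isoMk g
  have unitary : IsUnitary e.hom := (Herm.isUnitary_iff_of_iso e).2 <|
    (congrArg (g.hom ≫ ·) (Category.id_comp (dag (C := D.carrier) g.hom))).trans pairing_eq.symm
  let fullIso := ((canonicalPos k).obj D).positive.isoMk e
  exact ⟨z, fullIso.symm, IsUnitary.symm (full_isUnitary _ unitary)⟩

end HermPosEquivalence

end DaggerHerm

/-- In the monoidal, braided monoidal and symmetric monoidal settings: the Hermitian completion is
a strict 2-functor, right adjoint to the canonical 2-functor from dagger categories to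
anti-involutive categories, and `(C, P) ↦ C_P`, `D ↦ (D, Pos(D))` is a 2-equivalence. -/
theorem mainTheorem3 (k : DaggerHerm.Level) :
    (∃ H : StrictPseudofunctor (DaggerHerm.AICat.{v, max u v} k)
        (DaggerHerm.DagCat.{v, max u v} k),
      H.toPrelaxFunctorStruct = DaggerHerm.hermData k ∧
      Nonempty (DaggerHerm.TwoAdjunction (DaggerHerm.canonical k) H)) ∧
    (∃ HP : StrictPseudofunctor (DaggerHerm.AIPosCat.{v, max u v} k)
        (DaggerHerm.DagCat.{v, max u v} k),
      HP.toPrelaxFunctorStruct = DaggerHerm.hermPosData k ∧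
      ∃ E : DaggerHerm.TwoAdjunction (DaggerHerm.canonicalPos k) HP,
        (∀ D, DaggerHerm.IsEquivalence (E.unit.app D)) ∧
        (∀ C, DaggerHerm.IsEquivalence (E.counit.app C))) :=
  ⟨⟨(DaggerHerm.hermCouniversal.{v, u} k).rightAdjoint, rfl,
      ⟨(DaggerHerm.hermCouniversal.{v, u} k).adjunction⟩⟩,
    (DaggerHerm.hermPosCouniversal.{v, u} k).rightAdjoint, rfl,
    (DaggerHerm.hermPosCouniversal.{v, u} k).adjunction,
    DaggerHerm.isEquivalence_hermPosLift_id, DaggerHerm.isEquivalence_hermPosCounit⟩
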